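/- For a finite simple undirected graph $H$, an odd cycle transversal (OCT) of $H$ is a set $S\subseteq V(H)$ such that $H-S$ is bipartite. Let $H^2$ be the graph on $\{v_1,v_2 : v\in V(H)\}$ with edges $u_1v_1$ and $u_2v_2$ for every edge $uv$ of $H$, and $v_1v_2$ for every vertex $v$ of $H$. For $S\subseteq V(H)$ write $S_i=\{v_i : v\in S\}$. Let $T$ be an OCT of $H$ and $B=V(H)\setminus T$. The algorithm OCT-Disjoint-Compression$(H,T)$ is the following. For each set $Y\subseteq T_1\cup T_2$ that contains exactly one of $v_1,v_2$ for each $v\in T$: 1. if $Y$ is not a vertex cover of $H^2[T_1\cup T_2]$, go on to the next $Y$; 2. let $W\subseteq B_1\cup B_2$ be the set of the vertices that are adjacent to some vertex of $(T_1\cup T_2)\setminus Y$, use a polynomial-time subroutine for minimum vertex covers of bipartite graphs to obtain a minimum vertex cover $Z$ of the bipartite graph $H^2[(B_1\cup B_2)\setminus W]$, and let $X=Y\cup W\cup Z$; 3. let $T'=\{v\in V(H) : v_1,v_2\in X\}$; if $|T'|\le |T|-1$, return $T'$. If no choice of $Y$ leads to a set being returned, declare that there is no such $T'$. **Theorem.**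 There is a polynomial-time program, on a unit-cost random access machine with addition and truncated subtraction, that finds a minimum vertex cover of every given bipartite graph. For every such program used as the subroutine in step 2, there is a polynomial $p$ such that for every graph $H$ on $n$ vertices (given by its adjacency matrix) and every OCT $T$ of $H$, the algorithm OCT-Disjoint-Compression$(H,T)$ halts after at most $2^{|T|}\,p(n)$ steps and decides whether $H$ has an OCT $T'$ with $|T'|\le |T|-1$ and $T\cap T'=\emptyset$; if one exists, the algorithm returns one. In particular the problem is solved in $O^*(2^{|T|})$ time. -/

import Mathlib

/-! ### A random access machine with a step count

Programs of a unit-cost random access machine, in structured form. The memory consists of registers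
and of two-dimensional arrays (a one-dimensional array is row `0` of such an array), all holding
natural numbers. The only arithmetic is addition and truncated subtraction, so that the length of
a number grows by a constant at most in each step, and the running time is polynomially equivalent
to that of a Turing machine. Every operator, memory access, assignment and test is charged. -/

namespace RAM

/-- The memory: register `x` holds `reg x`, cell `a[i][j]` of the array `a` holds `mem a i j`. -/
structure State where
  reg : ℕ → ℕ
  mem : ℕ → ℕ → ℕ → ℕ

/-- Arithmetic expressions. -/
inductive Expr where
  | num (k : ℕ)
  | reg (x : ℕ)
  | get (a : ℕ) (i j : Expr)
  | add (e f : Expr)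
  | sub (e f : Expr)

/-- Tests. -/
inductive Test where
  | eq (e f : Expr)
  | lt (e f : Expr)
  | and (b c : Test)
  | not (b : Test)

/-- Value of an expression. -/
def Expr.eval (s : State) : Expr → ℕ
  | .num k => k
  | .reg x => s.reg x
  | .get a i j => s.mem a (i.eval s) (j.eval s)
  | .add e f => e.eval s + f.eval s
  | .sub e f => e.eval s - f.eval s

/-- Cost of an expression: the number of its nodes. -/
def Expr.cost : Expr → ℕ
  | .num _ => 1
  | .reg _ => 1
  | .get _ i j => i.cost + j.cost + 1
  | .add e f => e.cost + f.cost + 1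
  | .sub e f => e.cost + f.cost + 1

/-- Truth of a test. -/
def Test.Holds (s : State) : Test → Prop
  | .eq e f => e.eval s = f.eval s
  | .lt e f => e.eval s < f.eval s
  | .and b c => b.Holds s ∧ c.Holds s
  | .not b => ¬ b.Holds s

/-- Cost of a test: the number of its nodes. -/
def Test.cost : Test → ℕ
  | .eq e f => e.cost + f.cost + 1
  | .lt e f => e.cost + f.cost + 1
  | .and b c => b.cost + c.cost + 1
  | .not b => b.cost + 1

/-- Programs. -/
inductive Cmd where
  | skip
  | assign (x : ℕ) (e : Expr)
  | store (a : ℕ) (i j e : Expr)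
  | seq (c d : Cmd)
  | ite (b : Test) (c d : Cmd)
  | while (b : Test) (c : Cmd)

/-- The memory after `x := k`. -/
def State.setReg (s : State) (x k : ℕ) : State :=
  { s with reg := fun y => if y = x then k else s.reg y }

/-- The memory after `a[i][j] := k`. -/
def State.setMem (s : State) (a i j k : ℕ) : State :=
  { s with mem := fun a' i' j' => if a' = a ∧ i' = i ∧ j' = j then k else s.mem a' i' j' }

/-- `Exec c s t s'`: started in memory `s`, the program `c` halts after exactly `t` steps, in
memory `s'`. -/
inductive Exec : Cmd → State → ℕ → State → Prop
  | skip (s : State) : Exec .skip s 1 s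
  | assign (s : State) (x : ℕ) (e : Expr) :
      Exec (.assign x e) s (e.cost + 1) (s.setReg x (e.eval s))
  | store (s : State) (a : ℕ) (i j e : Expr) :
      Exec (.store a i j e) s (i.cost + j.cost + e.cost + 1)
        (s.setMem a (i.eval s) (j.eval s) (e.eval s))
  | seq {s s₁ s₂ : State} {c d : Cmd} {t₁ t₂ : ℕ} (h₁ : Exec c s t₁ s₁) (h₂ : Exec d s₁ t₂ s₂) :
      Exec (.seq c d) s (t₁ + t₂) s₂
  | ite_true {s s' : State} {b : Test} {c d : Cmd} {t : ℕ} (hb : b.Holds s) (h : Exec c s t s') :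
      Exec (.ite b c d) s (b.cost + 1 + t) s'
  | ite_false {s s' : State} {b : Test} {c d : Cmd} {t : ℕ} (hb : ¬ b.Holds s)
      (h : Exec d s t s') : Exec (.ite b c d) s (b.cost + 1 + t) s'
  | while_false {s : State} {b : Test} {c : Cmd} (hb : ¬ b.Holds s) :
      Exec (.while b c) s (b.cost + 1) s
  | while_true {s s₁ s₂ : State} {b : Test} {c : Cmd} {t₁ t₂ : ℕ} (hb : b.Holds s)
      (h₁ : Exec c s t₁ s₁) (h₂ : Exec (.while b c) s₁ t₂ s₂) :
      Exec (.while b c) s (b.cost + 1 + t₁ + t₂) s₂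

/-- The machine is deterministic: the running time and the result are determined by the input. -/
theorem Exec.deterministic {c : Cmd} {s s₁ s₂ : State} {t₁ t₂ : ℕ} (h₁ : Exec c s t₁ s₁)
    (h₂ : Exec c s t₂ s₂) : t₁ = t₂ ∧ s₁ = s₂ := by
  induction h₁ generalizing t₂ s₂ with
  | skip => cases h₂; exact ⟨rfl, rfl⟩
  | assign => cases h₂; exact ⟨rfl, rfl⟩
  | store => cases h₂; exact ⟨rfl, rfl⟩
  | seq _ _ ih₁ ih₂ =>
    cases h₂ with
    | seq g₁ g₂ =>
      obtain ⟨rfl, rfl⟩ := ih₁ g₁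
      obtain ⟨rfl, rfl⟩ := ih₂ g₂
      exact ⟨rfl, rfl⟩
  | ite_true hb _ ih =>
    cases h₂ with
    | ite_true _ g => obtain ⟨rfl, rfl⟩ := ih g; exact ⟨rfl, rfl⟩
    | ite_false hb' _ => exact absurd hb hb'
  | ite_false hb _ ih =>
    cases h₂ with
    | ite_true hb' _ => exact absurd hb' hb
    | ite_false _ g => obtain ⟨rfl, rfl⟩ := ih g; exact ⟨rfl, rfl⟩
  | while_false hb =>
    cases h₂ with
    | while_false _ => exact ⟨rfl, rfl⟩
    | while_true hb' _ _ => exact absurd hb' hb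
  | while_true hb _ _ ih₁ ih₂ =>
    cases h₂ with
    | while_false hb' => exact absurd hb hb'
    | while_true _ g₁ g₂ =>
      obtain ⟨rfl, rfl⟩ := ih₁ g₁
      obtain ⟨rfl, rfl⟩ := ih₂ g₂
      exact ⟨rfl, rfl⟩

/-- `for x := 0, 1, …, e - 1 do c`. -/
def Cmd.for (x : ℕ) (e : Expr) (c : Cmd) : Cmd :=
  .seq (.assign x (.num 0))
    (.while (.lt (.reg x) e) (.seq c (.assign x (.add (.reg x) (.num 1)))))

/-- `if b then c`. -/
def Cmd.when (b : Test) (c : Cmd) : Cmd := .ite b c .skip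

/-- Entry `i` of a one-dimensional array. -/
def Expr.get1 (a : ℕ) (i : Expr) : Expr := .get a (.num 0) i

/-- `a[i] := e` for a one-dimensional array `a`. -/
def Cmd.store1 (a : ℕ) (i e : Expr) : Cmd := .store a (.num 0) i e

/-- The test `e = k` for a constant `k`. -/
def Expr.is (e : Expr) (k : ℕ) : Test := .eq e (.num k)

end RAM

/-! ### The algorithm -/

namespace OCT

open RAM

infixr:60 " ;; " => RAM.Cmd.seq
infixr:65 " AND " => RAM.Test.and

/-- `S` is an odd cycle transversal of `G`: deleting `S` leaves a bipartite graph. -/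
def IsOCT {V : Type*} (G : SimpleGraph V) (S : Finset V) : Prop :=
  (G.induce ((S : Set V)ᶜ)).IsBipartite

/-! Registers: `rN` is the number of vertices of `H`, `rK` the size of `T`, `rN2` the number of
vertices of `H²`. The vertex `v₁` of `H²` has the number `v`, the vertex `v₂` the number `n + v`. -/
abbrev rN : ℕ := 0
abbrev rK : ℕ := 1
abbrev rN2 : ℕ := 2
abbrev rU : ℕ := 3
abbrev rV : ℕ := 4
abbrev rMore : ℕ := 5
abbrev rFound : ℕ := 6
abbrev rValid : ℕ := 7
abbrev rCount : ℕ := 8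
abbrev rCarry : ℕ := 9

/-! Arrays: adjacency matrix of `H`; indicator of `T`; adjacency matrix of `H²`; indicators of
`T₁ ∪ T₂`, `Y`, `W`, `(B₁ ∪ B₂) \ W`, `Z`, `X`, `T'`. -/
abbrev aAdj : ℕ := 0
abbrev aT : ℕ := 1
abbrev aSq : ℕ := 2
abbrev aTT : ℕ := 3
abbrev aY : ℕ := 4
abbrev aW : ℕ := 5
abbrev aRest : ℕ := 6
abbrev aZ : ℕ := 7
abbrev aX : ℕ := 8
abbrev aSol : ℕ := 9

/-- Registers and arrays with a number from here on are free for use by a subroutine. -/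
abbrev scratch : ℕ := 16

/-- Construction of `H²`: two copies of `H`, and an edge between the two copies of each vertex. -/
def buildSquare : Cmd :=
  .assign rN2 (.add (.reg rN) (.reg rN)) ;;
  .for rU (.reg rN) (.for rV (.reg rN) (
    .store aSq (.reg rU) (.reg rV) (.get aAdj (.reg rU) (.reg rV)) ;;
    .store aSq (.add (.reg rN) (.reg rU)) (.add (.reg rN) (.reg rV))
      (.get aAdj (.reg rU) (.reg rV)) ;;
    .when (.eq (.reg rU) (.reg rV)) (
      .store aSq (.reg rU) (.add (.reg rN) (.reg rV)) (.num 1) ;;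
      .store aSq (.add (.reg rN) (.reg rU)) (.reg rV) (.num 1))))

/-- Computation of `|T|` and of `T₁ ∪ T₂`, and the first choice of `Y`, which is `T₁`. -/
def initChoice : Cmd :=
  .assign rK (.num 0) ;;
  .for rV (.reg rN) (
    .assign rK (.add (.reg rK) (.get1 aT (.reg rV))) ;;
    .store1 aTT (.reg rV) (.get1 aT (.reg rV)) ;;
    .store1 aTT (.add (.reg rN) (.reg rV)) (.get1 aT (.reg rV)) ;;
    .store1 aY (.reg rV) (.get1 aT (.reg rV)) ;;
    .store1 aY (.add (.reg rN) (.reg rV)) (.num 0))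

/-- Test of the choice: `rValid` becomes `1` if `Y` is a vertex cover of `H²[T₁ ∪ T₂]`, and `0` otherwise. -/
def checkChoice : Cmd :=
  .assign rValid (.num 1) ;;
  .for rU (.reg rN2) (.for rV (.reg rN2) (
    .when ((Expr.get1 aTT (.reg rU)).is 1 AND (Expr.get1 aTT (.reg rV)).is 1 AND
        (Expr.get aSq (.reg rU) (.reg rV)).is 1 AND
        (Expr.get1 aY (.reg rU)).is 0 AND (Expr.get1 aY (.reg rV)).is 0)
      (.assign rValid (.num 0))))

/-- The set `W ⊆ B₁ ∪ B₂` of the vertices that are adjacent to some vertex in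
`(T₁ ∪ T₂) \ Y`, and the set `(B₁ ∪ B₂) \ W`. -/
def computeW : Cmd :=
  .for rU (.reg rN2) (
    .store1 aW (.reg rU) (.num 0) ;;
    .store1 aRest (.reg rU) (.num 0) ;;
    .when ((Expr.get1 aTT (.reg rU)).is 0) (
      .for rV (.reg rN2) (
        .when ((Expr.get1 aTT (.reg rV)).is 1 AND (Expr.get1 aY (.reg rV)).is 0 AND
            (Expr.get aSq (.reg rU) (.reg rV)).is 1)
          (.store1 aW (.reg rU) (.num 1))) ;;
      .when ((Expr.get1 aW (.reg rU)).is 0) (.store1 aRest (.reg rU) (.num 1))))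

/-- The set `X = Y ∪ W ∪ Z`. -/
def computeX : Cmd :=
  .for rU (.reg rN2) (
    .ite (.lt (.num 0) (.add (.get1 aY (.reg rU)) (.add (.get1 aW (.reg rU))
        (.get1 aZ (.reg rU)))))
      (.store1 aX (.reg rU) (.num 1))
      (.store1 aX (.reg rU) (.num 0)))

/-- The set `T'` of the vertices `v` with `v₁, v₂ ∈ X`, and the test `|T'| ≤ |T| - 1`. -/
def computeSol : Cmd :=
  .assign rCount (.num 0) ;;
  .for rV (.reg rN) (
    .ite ((Expr.get1 aX (.reg rV)).is 1 AND (Expr.get1 aX (.add (.reg rN) (.reg rV))).is 1)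
      (.store1 aSol (.reg rV) (.num 1) ;; .assign rCount (.add (.reg rCount) (.num 1)))
      (.store1 aSol (.reg rV) (.num 0))) ;;
  .when (.lt (.reg rCount) (.reg rK)) (.assign rFound (.num 1))

/-- The next choice of `Y`, in the order of a binary counter with one digit for each vertex of
`T`; after the last choice, `rMore` becomes `0`. -/
def nextChoice : Cmd :=
  .assign rCarry (.num 1) ;;
  .for rV (.reg rN) (
    .when ((Expr.reg rCarry).is 1 AND (Expr.get1 aT (.reg rV)).is 1) (
      .ite ((Expr.get1 aY (.reg rV)).is 1)
        (.store1 aY (.reg rV) (.num 0) ;;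
         .store1 aY (.add (.reg rN) (.reg rV)) (.num 1) ;;
         .assign rCarry (.num 0))
        (.store1 aY (.reg rV) (.num 1) ;;
         .store1 aY (.add (.reg rN) (.reg rV)) (.num 0)))) ;;
  .when ((Expr.reg rCarry).is 1) (.assign rMore (.num 0))

/-- The algorithm `OCT-Disjoint-Compression(H, T)`. The program `mvc` is the subroutine that obtains
a minimum vertex cover `Z` of `H²[(B₁ ∪ B₂) \ W]`. The loop is left as soon as a set `T'` is to be
returned (`rFound = 1`), or when all choices of `Y` have been tried. -/
def disjointCompression (mvc : Cmd) : Cmd :=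
  buildSquare ;;
  initChoice ;;
  .assign rFound (.num 0) ;;
  .assign rMore (.num 1) ;;
  .while ((Expr.reg rMore).is 1 AND (Expr.reg rFound).is 0) (
    checkChoice ;;
    .when ((Expr.reg rValid).is 1) (
      computeW ;;
      mvc ;;
      computeX ;;
      computeSol) ;;
    nextChoice)

/-- The one-dimensional array `a` holds the indicator function of the set `S`. -/
def HoldsSet {n : ℕ} (s : State) (a : ℕ) (S : Set (Fin n)) : Prop :=
  ∀ v : Fin n, (v ∈ S → s.mem a 0 v = 1) ∧ (v ∉ S → s.mem a 0 v = 0)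

/-- The array `a` holds the adjacency matrix of the graph `G`. -/
def HoldsGraph {n : ℕ} (s : State) (a : ℕ) (G : SimpleGraph (Fin n)) : Prop :=
  ∀ u v : Fin n, (G.Adj u v → s.mem a u v = 1) ∧ (¬ G.Adj u v → s.mem a u v = 0)

/-- `mvc` is a polynomial-time program for minimum vertex covers of bipartite graphs: given a graph
`G` on `{0, …, m - 1}` and a set `U` of vertices for which `G[U]` is bipartite, it writes a minimum
vertex cover of `G[U]` to the array `aZ` within a number of steps that is polynomial in `m`. Apart
from `aZ` it changes scratch memory only, on the contents of which it may not rely. -/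
def IsBipartiteVertexCoverRoutine (mvc : Cmd) : Prop :=
  ∃ p : Polynomial ℕ, ∀ (m : ℕ) (G : SimpleGraph (Fin m)) (U : Set (Fin m)) (s : State),
    (G.induce U).IsBipartite → s.reg rN2 = m → HoldsGraph s aSq G → HoldsSet s aRest U →
    ∃ (t : ℕ) (s' : State), Exec mvc s t s' ∧ t ≤ p.eval m ∧
      (∃ Z : Set U, (G.induce U).IsVertexCover Z ∧ Z.encard = (G.induce U).vertexCoverNum ∧
        HoldsSet s' aZ (Subtype.val '' Z)) ∧
      (∀ x < scratch, s'.reg x = s.reg x) ∧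
      (∀ a < scratch, a ≠ aZ → s'.mem a = s.mem a)

open Classical in
/-- The memory at the start: the number of vertices, the adjacency matrix of `H` and the indicator
of `T`; everything else is `0`. -/
noncomputable def inputState {n : ℕ} (H : SimpleGraph (Fin n)) (T : Finset (Fin n)) : State where
  reg x := if x = rN then n else 0
  mem a i j :=
    if a = aAdj ∧ ∃ u v : Fin n, u.val = i ∧ v.val = j ∧ H.Adj u v then 1
    else if a = aT ∧ i = 0 ∧ ∃ v ∈ T, v.val = j then 1
    else 0

/-- `T'` is an odd cycle transversal of `H` of size at most `|T| - 1` (an integer, which is `-1` for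
`T = ∅`) that is disjoint from `T`. -/
def IsDisjointCompression {n : ℕ} (H : SimpleGraph (Fin n)) (T T' : Finset (Fin n)) : Prop :=
  IsOCT H T' ∧ (T'.card : ℤ) ≤ (T.card : ℤ) - 1 ∧ Disjoint T T'

end OCT

/-! Vertex covers of `H²` encode odd cycle transversals. If `T'` is an OCT and `S` is a colour class
of a 2-colouring of `H - T'`, then `(T' ∪ S)₁ ∪ (T' ∪ Sᶜ)₂` is a vertex cover of `H²` of size `n +
|T'|`. Conversely, a vertex cover `X` meets every pair `{v₁, v₂}`, hence has size `n` plus the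
number of vertices with both copies in `X`. Those vertices form an OCT, because on the rest
membership of `v₁` in `X` is a proper 2-colouring.

Disjointness from `T` means that `X` contains exactly one copy of each vertex of `T`, so `X` meets
`T₁ ∪ T₂` in one of the `2^|T|` sets `Y`. Once `Y` is fixed, `W` is forced, and what remains to be
covered is a subgraph of `H²[B₁ ∪ B₂]`. This is bipartite: take the colouring of `H[B]` on the first
copy and the opposite one on the second. A minimum cover `Z` of it makes `Y ∪ W ∪ Z` as small as any
cover with the trace `Y` (`HasCompression.ncard_lt`). The sets `Y` are run through by a binary
counter that counts down; `rank` is its value, and `loop_runs` keeps the invariant that all choices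
of higher rank have failed.

A subroutine for bipartite graphs is obtained from an auction. After a 2-colouring has been
computed, the vertices of colour `0` bid for neighbours. Labels of bidders and prices of items only
grow, a label is at most the price of each neighbour, and a matched item costs exactly one more than
the label of its owner. The sum of labels and prices is bounded and grows in each round in which
some bidder is active. At the end a level `l` that is not a price is chosen by pigeonhole; the items
above the level and the bidders whose label plus one lies below it form a cover. Each of its
vertices is matched, and no matched pair lies entirely in it, so it is minimum by König's argument
(`encard_le_of_isVertexCover`).

Running times come from a small program logic: `Runs N` bounds the time by a polynomial, read off
from the program text, in a bound `N` for the number of iterations of any loop. Only the main loop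
and the unknown subroutine are treated with an explicit time bound, by `RunsIn`. -/

namespace RAM

/-! ### Frames, running times and a program logic for the machine. -/

/-- The registers that are assigned to in a program. -/
def Cmd.regs : Cmd → List ℕ
  | .skip => []
  | .assign x _ => [x]
  | .store _ _ _ _ => []
  | .seq c d => c.regs ++ d.regs
  | .ite _ c d => c.regs ++ d.regs
  | .while _ c => c.regs

/-- The arrays that are written to in a program. -/
def Cmd.arrs : Cmd → List ℕ
  | .skip => []
  | .assign _ _ => []
  | .store a _ _ _ => [a]
  | .seq c d => c.arrs ++ d.arrs
  | .ite _ c d => c.arrs ++ d.arrs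
  | .while _ c => c.arrs

/-- The memories `s` and `s'` agree on everything that is not written to in `c`. -/
structure Cmd.Frame (c : Cmd) (s s' : State) : Prop where
  reg : ∀ x, x ∉ c.regs → s'.reg x = s.reg x
  mem : ∀ a, a ∉ c.arrs → s'.mem a = s.mem a

theorem Cmd.Frame.refl (c : Cmd) (s : State) : c.Frame s s := ⟨fun _ _ => rfl, fun _ _ => rfl⟩

theorem Cmd.Frame.trans {c : Cmd} {s s₁ s₂ : State} (h₁ : c.Frame s s₁) (h₂ : c.Frame s₁ s₂) :
    c.Frame s s₂ :=
  ⟨fun x hx => (h₂.reg x hx).trans (h₁.reg x hx), fun a ha => (h₂.mem a ha).trans (h₁.mem a ha)⟩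

theorem Cmd.Frame.mono {c d : Cmd} {s s' : State} (h : c.Frame s s') (hr : c.regs ⊆ d.regs)
    (ha : c.arrs ⊆ d.arrs) : d.Frame s s' :=
  ⟨fun x hx => h.reg x fun hc => hx (hr hc), fun a hx => h.mem a fun hc => hx (ha hc)⟩

@[simp] theorem State.setReg_reg_self (s : State) (x k : ℕ) : (s.setReg x k).reg x = k := by
  simp [State.setReg]

theorem State.setReg_reg_of_ne (s : State) {x y : ℕ} (k : ℕ) (h : y ≠ x) :
    (s.setReg x k).reg y = s.reg y := by
  simp [State.setReg, h]

theorem State.setReg_reg (s : State) (x y k : ℕ) :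
    (s.setReg x k).reg y = if y = x then k else s.reg y := rfl

@[simp] theorem State.setReg_mem (s : State) (x k : ℕ) : (s.setReg x k).mem = s.mem := rfl

@[simp] theorem State.setMem_reg (s : State) (a i j k : ℕ) : (s.setMem a i j k).reg = s.reg := rfl

theorem State.setMem_mem_of_ne (s : State) {a b : ℕ} (i j k : ℕ) (h : b ≠ a) :
    (s.setMem a i j k).mem b = s.mem b := by
  funext i' j'
  simp [State.setMem, h]

theorem State.setMem_mem (s : State) (a b i j k i' j' : ℕ) :
    (s.setMem a i j k).mem b i' j' = if b = a ∧ i' = i ∧ j' = j then k else s.mem b i' j' := rfl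

/-- Invariants need not mention what a program leaves alone: the lists `regs` and `arrs` are
computed from its text, and non-membership is settled by `decide`. -/
theorem Exec.frame {c : Cmd} {s s' : State} {t : ℕ} (h : Exec c s t s') : c.Frame s s' := by
  induction h with
  | skip => exact .refl _ _
  | assign s x e =>
    refine ⟨fun y hy => ?_, fun _ _ => rfl⟩
    exact State.setReg_reg_of_ne s _ (by simpa [Cmd.regs] using hy)
  | store s a i j e =>
    refine ⟨fun _ _ => rfl, fun b hb => ?_⟩
    exact State.setMem_mem_of_ne s _ _ _ (by simpa [Cmd.arrs] using hb)
  | seq _ _ ih₁ ih₂ =>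
    exact (ih₁.mono (by simp [Cmd.regs]) (by simp [Cmd.arrs])).trans
      (ih₂.mono (by simp [Cmd.regs]) (by simp [Cmd.arrs]))
  | ite_true _ _ ih => exact ih.mono (by simp [Cmd.regs]) (by simp [Cmd.arrs])
  | ite_false _ _ ih => exact ih.mono (by simp [Cmd.regs]) (by simp [Cmd.arrs])
  | while_false => exact .refl _ _
  | while_true _ _ _ ih₁ ih₂ =>
    exact (ih₁.mono (by simp [Cmd.regs]) (by simp [Cmd.arrs])).trans ih₂

/-- Started in `s`, the program `c` halts within `T` steps, in a memory that satisfies `Q`. -/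
def RunsIn (T : ℕ) (c : Cmd) (s : State) (Q : State → Prop) : Prop :=
  ∃ t s', Exec c s t s' ∧ t ≤ T ∧ Q s'

/-- A bound for the running time of a program in which every loop is iterated at most `X` times
whenever it is entered. -/
noncomputable def Cmd.timePoly : Cmd → Polynomial ℕ
  | .skip => 1
  | .assign _ e => Polynomial.C (e.cost + 1)
  | .store _ i j e => Polynomial.C (i.cost + j.cost + e.cost + 1)
  | .seq c d => c.timePoly + d.timePoly
  | .ite b c d => Polynomial.C (b.cost + 1) + (c.timePoly + d.timePoly)
  | .while b c =>
    Polynomial.X * (Polynomial.C (b.cost + 1) + c.timePoly) + Polynomial.C (b.cost + 1)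

/-- Started in `s`, the program `c` halts in a memory that satisfies `Q`, within the time that it
takes if no loop is iterated more than `N` times. -/
def Runs (N : ℕ) (c : Cmd) (s : State) (Q : State → Prop) : Prop :=
  RunsIn (c.timePoly.eval N) c s Q

theorem RunsIn.mono {T T' : ℕ} {c : Cmd} {s : State} {Q Q' : State → Prop}
    (h : RunsIn T c s Q) (hT : T ≤ T') (hQ : ∀ s', c.Frame s s' → Q s' → Q' s') :
    RunsIn T' c s Q' := by
  obtain ⟨t, s', he, ht, hq⟩ := h
  exact ⟨t, s', he, ht.trans hT, hQ s' he.frame hq⟩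

theorem RunsIn.seq {T₁ T₂ : ℕ} {c d : Cmd} {s : State} {Q : State → Prop}
    (h : RunsIn T₁ c s fun s' => RunsIn T₂ d s' Q) : RunsIn (T₁ + T₂) (.seq c d) s Q := by
  obtain ⟨t, s', he, ht, t', s'', he', ht', hq⟩ := h
  exact ⟨t + t', s'', .seq he he', add_le_add ht ht', hq⟩

/-- The bounds of the branches are added rather than maximised, to match `timePoly`, which has to be
a polynomial. -/
theorem RunsIn.ite {T₁ T₂ : ℕ} {b : Test} {c d : Cmd} {s : State} {Q : State → Prop}
    (hc : b.Holds s → RunsIn T₁ c s Q) (hd : ¬ b.Holds s → RunsIn T₂ d s Q) :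
    RunsIn (b.cost + 1 + (T₁ + T₂)) (.ite b c d) s Q := by
  by_cases hb : b.Holds s
  · obtain ⟨t, s', he, ht, hq⟩ := hc hb
    exact ⟨_, s', .ite_true hb he, by omega, hq⟩
  · obtain ⟨t, s', he, ht, hq⟩ := hd hb
    exact ⟨_, s', .ite_false hb he, by omega, hq⟩

/-- The rule for loops: `I k s'` is to hold in the memory `s'` before an iteration if at most `k`
more iterations are needed. -/
theorem RunsIn.while {T K : ℕ} {b : Test} {c : Cmd} {s : State} {Q : State → Prop}
    (I : ℕ → State → Prop) (h0 : I K s)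
    (hstep : ∀ k s', c.Frame s s' → b.Holds s' → I k s' →
      0 < k ∧ RunsIn T c s' (I (k - 1)))
    (hQ : ∀ k s', c.Frame s s' → ¬ b.Holds s' → I k s' → Q s') :
    RunsIn (K * (b.cost + 1 + T) + (b.cost + 1)) (.while b c) s Q := by
  -- Induction on the number of iterations left; the frame relative to the initial memory `s` is
  -- carried along so that `hstep` and `hQ` may use it.
  have key : ∀ k s', c.Frame s s' → I k s' →
      RunsIn (k * (b.cost + 1 + T) + (b.cost + 1)) (.while b c) s' Q := by
    intro k
    induction k with
    | zero =>
      intro s' hf hI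
      by_cases hb : b.Holds s'
      · exact absurd (hstep 0 s' hf hb hI).1 (lt_irrefl 0)
      · exact ⟨_, s', .while_false hb, by omega, hQ 0 s' hf hb hI⟩
    | succ k ih =>
      intro s' hf hI
      by_cases hb : b.Holds s'
      · obtain ⟨-, t, s₁, he, ht, h1⟩ := hstep _ s' hf hb hI
        obtain ⟨t', s₂, he', ht', hq⟩ := ih s₁ (hf.trans he.frame) h1
        refine ⟨_, s₂, .while_true hb he he', ?_, hq⟩
        rw [add_mul, one_mul]
        omega
      · exact ⟨_, s', .while_false hb, by omega, hQ _ s' hf hb hI⟩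
  exact key K s (.refl _ _) h0

section Runs

variable {N : ℕ} {s : State} {Q : State → Prop}

theorem Runs.mono {c : Cmd} {Q' : State → Prop} (h : Runs N c s Q')
    (hQ : ∀ s', c.Frame s s' → Q' s' → Q s') : Runs N c s Q :=
  RunsIn.mono h le_rfl hQ

theorem Runs.skip (h : Q s) : Runs N .skip s Q :=
  ⟨1, s, .skip s, by simp [Cmd.timePoly], h⟩

theorem Runs.assign {x : ℕ} {e : Expr} (h : Q (s.setReg x (e.eval s))) :
    Runs N (.assign x e) s Q :=
  ⟨_, _, .assign s x e, by simp [Cmd.timePoly], h⟩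

theorem Runs.store {a : ℕ} {i j e : Expr} (h : Q (s.setMem a (i.eval s) (j.eval s) (e.eval s))) :
    Runs N (.store a i j e) s Q :=
  ⟨_, _, .store s a i j e, by simp [Cmd.timePoly], h⟩

theorem Runs.store1 {a : ℕ} {i e : Expr} (h : Q (s.setMem a 0 (i.eval s) (e.eval s))) :
    Runs N (.store1 a i e) s Q :=
  Runs.store h

theorem Runs.seq {c d : Cmd} (h : Runs N c s fun s' => Runs N d s' Q) :
    Runs N (.seq c d) s Q := by
  have := RunsIn.seq h
  simpa [Runs, Cmd.timePoly] using this

theorem Runs.ite {b : Test} {c d : Cmd} (hc : b.Holds s → Runs N c s Q)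
    (hd : ¬ b.Holds s → Runs N d s Q) : Runs N (.ite b c d) s Q := by
  have := RunsIn.ite hc hd
  simpa [Runs, Cmd.timePoly] using this

theorem Runs.when {b : Test} {c : Cmd} (hc : b.Holds s → Runs N c s Q)
    (hd : ¬ b.Holds s → Q s) : Runs N (.when b c) s Q :=
  Runs.ite hc fun hb => Runs.skip (hd hb)

/-- The rule for counting loops, with an invariant that may depend on the counter. -/
theorem Runs.for {K x : ℕ} {e : Expr} {c : Cmd} (I : ℕ → State → Prop)
    (hx : x ∉ c.regs) (hK : K ≤ N) (he : ∀ s', (Cmd.for x e c).Frame s s' → e.eval s' = K)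
    (h0 : I 0 (s.setReg x 0))
    (hstep : ∀ k s', k < K → (Cmd.for x e c).Frame s s' → s'.reg x = k → I k s' →
      Runs N c s' fun s'' => I (k + 1) (s''.setReg x (k + 1)))
    (hQ : ∀ s', (Cmd.for x e c).Frame s s' → s'.reg x = K → I K s' → Q s') :
    Runs N (.for x e c) s Q := by
  -- The inner loop starts after `x := 0`, but its frame can be referred to `s`, since `x` is among
  -- the registers of the whole loop.
  have hframe : ∀ {s' : State},
      (Cmd.seq c (.assign x (.add (.reg x) (.num 1)))).Frame (s.setReg x 0) s' →
      (Cmd.for x e c).Frame s s' := by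
    intro s' hf
    refine ⟨fun y hy => ?_, fun a ha => hf.mem a (by simpa [Cmd.for, Cmd.arrs] using ha)⟩
    have hy' : y ≠ x := by
      rintro rfl
      simp [Cmd.for, Cmd.regs] at hy
    rw [hf.reg y (by simpa [Cmd.for, Cmd.regs, hy'] using hy), State.setReg_reg_of_ne _ _ hy']
  refine Runs.seq (Runs.assign ?_)
  -- The `4` is the cost of incrementing the counter. The rule for `while` counts down, so the
  -- counter holds `K - k` when `k` iterations are left.
  have := RunsIn.while (b := .lt (.reg x) e) (c := .seq c (.assign x (.add (.reg x) (.num 1))))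
    (s := s.setReg x 0) (Q := Q) (T := c.timePoly.eval N + 4) (K := K)
    (fun k s' => k ≤ K ∧ s'.reg x = K - k ∧ I (K - k) s') (by simpa using h0) ?_ ?_
  · refine this.mono ?_ fun _ _ h => h
    simp only [Cmd.timePoly, Polynomial.eval_add, Polynomial.eval_mul, Polynomial.eval_X,
      Polynomial.eval_C, Expr.cost]
    gcongr
  · rintro k s' hf hb ⟨hk, hr, hI⟩
    have hf' := hframe hf
    have hlt : K - k < K := by
      have : s'.reg x < e.eval s' := hb
      rwa [hr, he s' hf'] at this
    refine ⟨by omega, RunsIn.seq ?_⟩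
    refine RunsIn.mono (hstep (K - k) s' hlt hf' hr hI) le_rfl fun s'' hfc hI' => ?_
    refine ⟨_, _, .assign _ _ _, by simp [Expr.cost], ?_⟩
    have hrx : s''.reg x = K - k := (hfc.reg x hx).trans hr
    have hidx : K - (k - 1) = K - k + 1 := by omega
    simp only [Expr.eval, hrx, hidx, State.setReg_reg_self]
    exact ⟨by omega, trivial, hI'⟩
  · rintro k s' hf hb ⟨hk, hr, hI⟩
    have hf' := hframe hf
    have hk0 : k = 0 := by
      have : ¬ s'.reg x < e.eval s' := hb
      rw [hr, he s' hf'] at this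
      omega
    subst hk0
    exact hQ s' hf' hr hI

end Runs

end RAM

namespace RAM

attribute [simp] Expr.eval Test.Holds Expr.get1 Expr.is State.setReg_reg State.setMem_mem

end RAM

/-! ### A polynomial-time subroutine for minimum vertex covers of bipartite graphs. -/

namespace BipartiteCover

open RAM OCT

/-! Registers and arrays of the subroutine for minimum vertex covers of bipartite graphs. -/
abbrev rI : ℕ := 16
abbrev rJ : ℕ := 17
abbrev rL : ℕ := 18
abbrev rA : ℕ := 19
abbrev rB : ℕ := 20
abbrev rFlip : ℕ := 21
abbrev rRounds : ℕ := 22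
abbrev rRound : ℕ := 23
abbrev rBad : ℕ := 24
abbrev rLevel : ℕ := 25
abbrev aComp : ℕ := 16
abbrev aCol : ℕ := 17
abbrev aLabel : ℕ := 18
abbrev aPrice : ℕ := 19
abbrev aMate : ℕ := 20
abbrev aOwner : ℕ := 21

/-! ### A proper 2-colouring -/

/-- Every vertex becomes a component of its own. -/
def initColoring : Cmd :=
  .for rI (.reg rN2) (
    .store1 aComp (.reg rI) (.reg rI) ;;
    .store1 aCol (.reg rI) (.num 0))

/-- The component with the number `rB` is joined to the one with the number `rA`, and the colours
of its vertices are flipped if `rFlip = 1`. -/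
def mergeComponents : Cmd :=
  .for rL (.reg rN2) (
    .when (.eq (.get1 aComp (.reg rL)) (.reg rB)) (
      .store1 aComp (.reg rL) (.reg rA) ;;
      .when ((Expr.reg rFlip).is 1)
        (.store1 aCol (.reg rL) (.sub (.num 1) (.get1 aCol (.reg rL))))))

/-- A 2-colouring of the graph that is induced by `aRest`. -/
def coloring : Cmd :=
  initColoring ;;
  .for rI (.reg rN2) (.for rJ (.reg rN2) (
    .when ((Expr.get1 aRest (.reg rI)).is 1 AND (Expr.get1 aRest (.reg rJ)).is 1 AND
        (Expr.get aSq (.reg rI) (.reg rJ)).is 1 AND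
        (.not (.eq (.get1 aComp (.reg rI)) (.get1 aComp (.reg rJ))))) (
      .assign rA (.get1 aComp (.reg rI)) ;;
      .assign rB (.get1 aComp (.reg rJ)) ;;
      .ite (.eq (.get1 aCol (.reg rI)) (.get1 aCol (.reg rJ)))
        (.assign rFlip (.num 1)) (.assign rFlip (.num 0)) ;;
      mergeComponents)))

/-- The input of the subroutine, as functions on the natural numbers. -/
structure Input (m : ℕ) (adj : ℕ → ℕ → ℕ) (rest : ℕ → ℕ) (s : State) : Prop where
  size : s.reg rN2 = m
  adj : s.mem aSq = adj
  rest : s.mem aRest 0 = rest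

theorem Input.frame {m : ℕ} {adj : ℕ → ℕ → ℕ} {rest : ℕ → ℕ} {c : Cmd} {s s' : State}
    (h : Input m adj rest s) (hf : c.Frame s s')
    (hc : rN2 ∉ c.regs ∧ aSq ∉ c.arrs ∧ aRest ∉ c.arrs := by decide) : Input m adj rest s' :=
  ⟨(hf.reg _ hc.1).trans h.size, (hf.mem _ hc.2.1).trans h.adj,
    (congrFun (hf.mem _ hc.2.2) 0).trans h.rest⟩

/-- `u` and `v` are adjacent vertices of the induced subgraph. -/
def IsEdge (m : ℕ) (adj : ℕ → ℕ → ℕ) (rest : ℕ → ℕ) (u v : ℕ) : Prop :=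
  u < m ∧ v < m ∧ rest u = 1 ∧ rest v = 1 ∧ adj u v = 1

/-- The colours agree with the proper colouring `c` up to a flip on every component, and the
endpoints of the edges in `D` are in the same component. -/
structure ColoringInv (m : ℕ) (adj : ℕ → ℕ → ℕ) (rest c comp col : ℕ → ℕ) (D : ℕ → ℕ → Prop) :
    Prop where
  le_one : ∀ v < m, col v ≤ 1
  agree : ∀ u < m, ∀ v < m, comp u = comp v → (col u = col v ↔ c u = c v)
  joined : ∀ u v, D u v → IsEdge m adj rest u v → comp u = comp v

variable {m N : ℕ} {adj : ℕ → ℕ → ℕ} {rest : ℕ → ℕ}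

theorem ColoringInv.congr {c comp col : ℕ → ℕ} {D D' : ℕ → ℕ → Prop}
    (h : ColoringInv m adj rest c comp col D) (hD : ∀ u v, IsEdge m adj rest u v → D' u v → D u v) :
    ColoringInv m adj rest c comp col D' :=
  ⟨h.le_one, h.agree, fun u v hd he => h.joined u v (hD u v he hd) he⟩

/-- The proper colouring `c` occurs in the analysis only. Both components agree with `c` up to a
flip, and `c u ≠ c v`; flipping the component of `v` exactly when `u` and `v` have equal colours
makes the two flips coincide. -/
theorem ColoringInv.merge {c comp col comp' col' : ℕ → ℕ} {D : ℕ → ℕ → Prop} {u v flip : ℕ}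
    (h : ColoringInv m adj rest c comp col D) (hc1 : ∀ v, c v ≤ 1)
    (hc : ∀ u v, IsEdge m adj rest u v → c u ≠ c v)
    (he : IsEdge m adj rest u v) (hflip : flip = if col u = col v then 1 else 0)
    (hcomp : ∀ w < m, comp' w = if comp w = comp v then comp u else comp w)
    (hcol : ∀ w < m, col' w = if comp w = comp v ∧ flip = 1 then 1 - col w else col w) :
    ColoringInv m adj rest c comp' col' (fun i j => D i j ∨ (i = u ∧ j = v)) := by
  have hu := he.1
  have hv := he.2.1
  have huv := hc u v he
  have hle : ∀ w < m, col' w ≤ 1 := by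
    intro w hw
    have := h.le_one w hw
    rw [hcol w hw]
    split <;> omega
  -- All vertices of the merged component are compared with the old colour of `u`; two of them are
  -- then compared with each other through `u`.
  have key : ∀ w < m, comp' w = comp u → (col' w = col u ↔ c w = c u) := by
    intro w hw hwu
    have b1 := h.le_one w hw
    have b2 := h.le_one u hu
    have b3 := h.le_one v hv
    have c1 := hc1 w
    have c2 := hc1 u
    have c3 := hc1 v
    rw [hcomp w hw] at hwu
    rw [hcol w hw, hflip]
    by_cases hwv : comp w = comp v
    · have := h.agree w hw v hv hwv
      by_cases hcuv : col u = col v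
      · rw [if_pos ⟨hwv, if_pos hcuv⟩]
        omega
      · rw [if_neg (by simp [hcuv])]
        omega
    · rw [if_neg hwv] at hwu
      rw [if_neg (by simp [hwv])]
      exact h.agree w hw u hu hwu
  refine ⟨hle, fun x hx y hy hxy => ?_, ?_⟩
  · by_cases hxu : comp' x = comp u
    · have k1 := key x hx hxu
      have k2 := key y hy (hxy.symm.trans hxu)
      have := hle x hx
      have := hle y hy
      have := h.le_one u hu
      have := hc1 x
      have := hc1 y
      have := hc1 u
      omega
    · have hyu : comp' y ≠ comp u := fun h' => hxu (hxy.trans h')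
      have hxv : comp x ≠ comp v := fun h' => hxu (by rw [hcomp x hx, if_pos h'])
      have hyv : comp y ≠ comp v := fun h' => hyu (by rw [hcomp y hy, if_pos h'])
      rw [hcomp x hx, hcomp y hy, if_neg hxv, if_neg hyv] at hxy
      rw [hcol x hx, hcol y hy, if_neg (by simp [hxv]), if_neg (by simp [hyv])]
      exact h.agree x hx y hy hxy
  · rintro x y (hd | ⟨rfl, rfl⟩) hxy
    · rw [hcomp x hxy.1, hcomp y hxy.2.1, h.joined x y hd hxy]
    · rw [hcomp _ hu, hcomp _ hv]
      simp

theorem initColoring_runs {s : State} (hs : Input m adj rest s) (hN : m ≤ N) (c : ℕ → ℕ) :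
    Runs N initColoring s fun s' =>
      ColoringInv m adj rest c (s'.mem aComp 0) (s'.mem aCol 0) fun _ _ => False := by
  refine Runs.for (K := m)
    (fun k s' => ∀ v < k, s'.mem aComp 0 v = v ∧ s'.mem aCol 0 v = 0)
    (by decide) hN (fun s' hf => (hs.frame hf).size) (by simp) ?_ ?_
  · intro k s' hk hf hr hI
    refine Runs.seq (Runs.store1 (Runs.store1 ?_))
    intro v hv
    have := hI v
    simp +decide [hr]
    grind
  · intro s' hf hr hI
    refine ⟨fun v hv => by simp [hI v hv], fun u hu v hv huv => ?_, fun _ _ h => h.elim⟩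
    rw [(hI u hu).1, (hI v hv).1] at huv
    simp [huv]

theorem mergeComponents_runs {s : State} (hs : Input m adj rest s) (hN : m ≤ N) :
    Runs N mergeComponents s fun s' => ∀ w < m,
      s'.mem aComp 0 w = (if s.mem aComp 0 w = s.reg rB then s.reg rA else s.mem aComp 0 w) ∧
      s'.mem aCol 0 w = (if s.mem aComp 0 w = s.reg rB ∧ s.reg rFlip = 1 then 1 - s.mem aCol 0 w
        else s.mem aCol 0 w) := by
  refine Runs.for (K := m)
    (fun k s' => ∀ w,
      s'.mem aComp 0 w = (if w < k ∧ s.mem aComp 0 w = s.reg rB then s.reg rA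
        else s.mem aComp 0 w) ∧
      s'.mem aCol 0 w = (if w < k ∧ s.mem aComp 0 w = s.reg rB ∧ s.reg rFlip = 1
        then 1 - s.mem aCol 0 w else s.mem aCol 0 w))
    (by decide) hN (fun s' hf => (hs.frame hf).size) (by simp) ?_ ?_
  · intro k s' hk hf hr hI
    have hA := hf.reg rA (by decide)
    have hB := hf.reg rB (by decide)
    have hF := hf.reg rFlip (by decide)
    have hIk := hI k
    simp only [lt_irrefl, false_and, if_false] at hIk
    refine Runs.when (fun hb => Runs.seq (Runs.store1
      (Runs.when (fun hb' => Runs.store1 ?_) fun hb' => ?_))) fun hb => ?_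
    all_goals
      intro w
      have := hI w
      simp +decide [hr, hA, hB, hIk] at hb ⊢
      try simp +decide [hF] at hb'
      grind
  · intro s' hf hr hI w hw
    have := hI w
    simpa [hw] using this

theorem coloring_runs {s : State} {c : ℕ → ℕ} (hs : Input m adj rest s) (hN : m ≤ N)
    (hc1 : ∀ v, c v ≤ 1) (hc : ∀ u v, IsEdge m adj rest u v → c u ≠ c v) :
    Runs N coloring s fun s' => (∀ v < m, s'.mem aCol 0 v ≤ 1) ∧
      ∀ u v, IsEdge m adj rest u v → s'.mem aCol 0 u ≠ s'.mem aCol 0 v := by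
  refine Runs.seq ((initColoring_runs hs hN c).mono fun s₁ hf₁ h₁ => ?_)
  have hs₁ := hs.frame hf₁
  refine Runs.for (K := m) (fun k s' => ColoringInv m adj rest c (s'.mem aComp 0) (s'.mem aCol 0)
      fun i _ => i < k)
    (by decide) hN (fun s' hf => (hs₁.frame hf).size) (h₁.congr (by simp)) ?_ ?_
  · intro i s₂ hi hf₂ hr₂ h₂
    have hs₂ := hs₁.frame hf₂
    refine Runs.for (K := m) (fun k s' => ColoringInv m adj rest c (s'.mem aComp 0) (s'.mem aCol 0)
        fun a b => a < i ∨ (a = i ∧ b < k))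
      (by decide) hN (fun s' hf => (hs₂.frame hf).size) (h₂.congr (by simp)) ?_ ?_
    · intro j s₃ hj hf₃ hr₃ h₃
      have hs₃ := hs₂.frame hf₃
      have hr₃' : s₃.reg rI = i := (hf₃.reg _ (by decide)).trans hr₂
      refine Runs.when (fun hb => ?_) fun hb => ?_
      · simp only [Test.Holds, Expr.is, Expr.get1, Expr.eval, hs₃.adj, hs₃.rest, hr₃, hr₃'] at hb
        obtain ⟨hb1, hb2, hb3, hb4⟩ := hb
        have he : IsEdge m adj rest i j := ⟨hi, hj, hb1, hb2, hb3⟩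
        have key : ∀ s₄ : State, s₄.mem = s₃.mem → s₄.reg rN2 = s₃.reg rN2 →
            s₄.reg rA = s₃.mem aComp 0 i → s₄.reg rB = s₃.mem aComp 0 j →
            (s₄.reg rFlip = if s₃.mem aCol 0 i = s₃.mem aCol 0 j then 1 else 0) →
            Runs N mergeComponents s₄ fun s' => ColoringInv m adj rest c
              ((s'.setReg rJ (j + 1)).mem aComp 0) ((s'.setReg rJ (j + 1)).mem aCol 0)
              fun a b => a < i ∨ (a = i ∧ b < j + 1) := by
          intro s₄ hm hn hA hB hF
          have hs₄ : Input m adj rest s₄ :=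
            ⟨hn.trans hs₃.size, by rw [hm, hs₃.adj], by rw [hm, hs₃.rest]⟩
          refine (mergeComponents_runs hs₄ hN).mono fun s₅ hf₅ h₅ => ?_
          rw [hm, hA, hB] at h₅
          have := h₃.merge (comp' := s₅.mem aComp 0) (col' := s₅.mem aCol 0) hc1 hc he hF
            (fun w hw => (h₅ w hw).1) (fun w hw => (h₅ w hw).2)
          refine this.congr fun a b _ => ?_
          grind
        refine Runs.seq (Runs.assign (Runs.seq (Runs.assign (Runs.seq (Runs.ite (fun h => Runs.assign
          (key _ ?_ ?_ ?_ ?_ ?_)) (fun h => Runs.assign (key _ ?_ ?_ ?_ ?_ ?_)))))))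
        all_goals simp +decide [hr₃, hr₃'] at h ⊢
        all_goals exact h
      · simp only [Test.Holds, Expr.is, Expr.get1, Expr.eval, hs₃.adj, hs₃.rest, hr₃, hr₃',
          not_and, not_not] at hb
        refine ⟨h₃.le_one, h₃.agree, fun a b hab he => ?_⟩
        by_cases hd : a < i ∨ (a = i ∧ b < j)
        · exact h₃.joined a b hd he
        · obtain rfl : a = i := by omega
          obtain rfl : b = j := by omega
          -- For an edge, the test can only have failed because the endpoints are already in one
          -- component.
          exact hb he.2.2.1 he.2.2.2.1 he.2.2.2.2
    · intro s₃ hf₃ hr₃ h₃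
      exact h₃.congr fun a b he h => by have := he.2.1; show _ ∨ _; omega
  · intro s₂ hf₂ hr₂ h₂
    refine ⟨h₂.le_one, fun u v he => ?_⟩
    have := h₂.agree u he.1 v he.2.1 (h₂.joined u v he.1 he)
    exact fun h => hc u v he (this.1 h)

end BipartiteCover

namespace BipartiteCover

open RAM OCT

variable {m N : ℕ} {adj : ℕ → ℕ → ℕ} {rest col : ℕ → ℕ}

/-! ### A maximum matching, by an auction

The vertices of colour `0` are the bidders, the other ones are the items. -/

/-- All vertices are unmatched, and all labels and prices are `0`. The register `rRounds` becomes
larger than the sum of all labels and prices can ever be. -/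
def initAuction : Cmd :=
  .assign rRounds (.num 0) ;;
  .for rI (.add (.reg rN2) (.num 1)) (
    .assign rRounds (.add (.reg rRounds) (.add (.add (.reg rN2) (.reg rN2)) (.num 2)))) ;;
  .for rI (.reg rN2) (
    .store1 aLabel (.reg rI) (.num 0) ;;
    .store1 aPrice (.reg rI) (.num 0) ;;
    .store1 aMate (.reg rI) (.num 0) ;;
    .store1 aOwner (.reg rI) (.num 0))

/-- If the bidder `rI` is unmatched and the price of the item `rJ` is not above its label, it gets
this item, and the price is raised above the label. -/
def bid : Cmd :=
  .when ((Expr.get1 aMate (.reg rI)).is 0 AND (Expr.get1 aRest (.reg rJ)).is 1 AND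
      (Expr.get aSq (.reg rI) (.reg rJ)).is 1 AND
      (.not (.lt (.get1 aLabel (.reg rI)) (.get1 aPrice (.reg rJ))))) (
    .when (.lt (.num 0) (.get1 aOwner (.reg rJ)))
      (.store1 aMate (.sub (.get1 aOwner (.reg rJ)) (.num 1)) (.num 0)) ;;
    .store1 aOwner (.reg rJ) (.add (.reg rI) (.num 1)) ;;
    .store1 aMate (.reg rI) (.add (.reg rJ) (.num 1)) ;;
    .store1 aPrice (.reg rJ) (.add (.get1 aLabel (.reg rI)) (.num 1)))

/-- The bidder `rI` tries to get an item. If this fails, its label is raised. -/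
def serve : Cmd :=
  .when ((Expr.get1 aRest (.reg rI)).is 1 AND (Expr.get1 aCol (.reg rI)).is 0 AND
      (Expr.get1 aMate (.reg rI)).is 0 AND
      (.lt (.get1 aLabel (.reg rI)) (.add (.reg rN2) (.num 1)))) (
    .for rJ (.reg rN2) bid ;;
    .when ((Expr.get1 aMate (.reg rI)).is 0)
      (.store1 aLabel (.reg rI) (.add (.get1 aLabel (.reg rI)) (.num 1))))

/-- The auction. -/
def auction : Cmd :=
  initAuction ;;
  .for rRound (.reg rRounds) (.for rI (.reg rN2) serve)

/-- The input of the subroutine, together with a colouring. -/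
structure ColoredInput (m : ℕ) (adj : ℕ → ℕ → ℕ) (rest col : ℕ → ℕ) (s : State) : Prop
    extends Input m adj rest s where
  col : s.mem aCol 0 = col

theorem ColoredInput.frame {c : Cmd} {s s' : State} (h : ColoredInput m adj rest col s)
    (hf : c.Frame s s') (hc : rN2 ∉ c.regs ∧ aSq ∉ c.arrs ∧ aRest ∉ c.arrs := by decide)
    (hc' : aCol ∉ c.arrs := by decide) : ColoredInput m adj rest col s' :=
  ⟨h.toInput.frame hf hc, (congrFun (hf.mem _ hc') 0).trans h.col⟩

/-- The invariant of the auction. The functions `L`, `P`, `F`, `O` are the labels of the bidders,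
the prices of the items, the items of the bidders and the owners of the items. -/
structure AuctionInv (m : ℕ) (adj : ℕ → ℕ → ℕ) (rest col L P F O : ℕ → ℕ) : Prop where
  le : ∀ i j, IsEdge m adj rest i j → col i = 0 → L i ≤ P j
  mate_iff : ∀ i < m, ∀ j < m, F i = j + 1 ↔ O j = i + 1
  owner : ∀ i, ∀ j < m, O j = i + 1 → IsEdge m adj rest i j ∧ col i = 0 ∧ P j = L i + 1
  mate_le : ∀ i < m, F i ≤ m
  price : ∀ j < m, O j = 0 → P j = 0
  label_le : ∀ i < m, L i ≤ m + 1
  price_le : ∀ j < m, P j ≤ m + 1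

/-- The sum of the labels and prices. -/
def potential (m : ℕ) (L P : ℕ → ℕ) : ℕ := ∑ v ∈ Finset.range m, (L v + P v)

/-- The bidder `i` is going to bid. -/
def IsActive (m : ℕ) (rest col L F : ℕ → ℕ) (i : ℕ) : Prop :=
  rest i = 1 ∧ col i = 0 ∧ F i = 0 ∧ L i < m + 1

theorem potential_lt {L P L' P' : ℕ → ℕ} {v : ℕ} (hv : v < m) (hL : ∀ w < m, L w ≤ L' w)
    (hP : ∀ w < m, P w ≤ P' w) (h : L v + P v < L' v + P' v) :
    potential m L P + 1 ≤ potential m L' P' := by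
  refine Nat.succ_le_of_lt (Finset.sum_lt_sum (fun w hw => ?_) ⟨v, Finset.mem_range.2 hv, h⟩)
  have := Finset.mem_range.1 hw
  exact add_le_add (hL w this) (hP w this)

theorem AuctionInv.potential_le {L P F O : ℕ → ℕ} (h : AuctionInv m adj rest col L P F O) :
    potential m L P ≤ m * (2 * m + 2) := by
  refine (Finset.sum_le_card_nsmul _ _ (2 * m + 2) fun v hv => ?_).trans (by simp)
  have := h.label_le v (Finset.mem_range.1 hv)
  have := h.price_le v (Finset.mem_range.1 hv)
  omega

/-- Mates and owners are stored shifted by one, with `0` for none, so `w + 1 = O j` singles out the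
displaced owner and is never true for an unowned item. Raising a price cannot violate `L ≤ P`. -/
theorem AuctionInv.assign {L P F O P' F' O' : ℕ → ℕ} {i j : ℕ}
    (h : AuctionInv m adj rest col L P F O) (he : IsEdge m adj rest i j) (hi : col i = 0)
    (hF : F i = 0) (hL : L i < m + 1) (hP : P j ≤ L i)
    (hP' : ∀ w, P' w = if w = j then L i + 1 else P w)
    (hO' : ∀ w, O' w = if w = j then i + 1 else O w)
    (hF' : ∀ w, F' w = if w = i then j + 1 else if w + 1 = O j then 0 else F w) :
    AuctionInv m adj rest col L P' F' O' := by
  have him := he.1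
  have hjm := he.2.1
  refine ⟨fun a b hab ha => ?_, fun a ha b hb => ?_, fun a b hb hab => ?_, fun a ha => ?_,
    fun b hb hb0 => ?_, h.label_le, fun b hb => ?_⟩
  · have h1 := h.le a b hab ha
    rw [hP']
    split
    · next hbj => subst hbj; omega
    · exact h1
  · have h1 := h.mate_iff a ha b hb
    have h2 := h.mate_iff a ha j hjm
    have h3 := h.mate_iff i him b hb
    rw [hF', hO']
    grind
  · have h1 := h.owner a b hb
    have h2 := h.mate_iff
    rw [hO'] at hab
    rw [hP']
    by_cases hbj : b = j
    · rw [if_pos hbj] at hab ⊢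
      obtain rfl : i = a := by omega
      exact ⟨hbj ▸ he, hi, rfl⟩
    · rw [if_neg hbj] at hab ⊢
      exact h1 hab
  · have := h.mate_le a ha
    rw [hF']
    split_ifs <;> omega
  · have := h.price b hb
    rw [hO'] at hb0
    rw [hP']
    split_ifs at hb0 ⊢
    exact this hb0
  · have := h.price_le b hb
    rw [hP']
    split_ifs <;> omega

/-- Every neighbour is strictly more expensive than the label, so there is room to raise it by one;
as the bidder owns nothing, the equation between prices and labels of owners is unaffected. -/
theorem AuctionInv.raise {L P F O L' : ℕ → ℕ} {i : ℕ}
    (h : AuctionInv m adj rest col L P F O) (hF : F i = 0) (hi : i < m) (hL : L i < m + 1)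
    (hP : ∀ j, IsEdge m adj rest i j → L i < P j)
    (hL' : ∀ w, L' w = if w = i then L i + 1 else L w) :
    AuctionInv m adj rest col L' P F O := by
  refine ⟨fun a b hab ha => ?_, h.mate_iff, fun a b hb hab => ?_, h.mate_le, h.price,
    fun a ha => ?_, h.price_le⟩
  · have h1 := h.le a b hab ha
    rw [hL']
    split
    · next hai => subst hai; exact hP b hab
    · exact h1
  · obtain ⟨h1, h2, h3⟩ := h.owner a b hb hab
    have hai : a ≠ i := by
      rintro rfl
      have := (h.mate_iff a h1.1 b hb).2 hab
      omega
    rw [hL', if_neg hai]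
    exact ⟨h1, h2, h3⟩
  · have := h.label_le a ha
    rw [hL']
    split_ifs <;> omega

/-- The memory holds a state of the auction. -/
abbrev AuctionState (m : ℕ) (adj : ℕ → ℕ → ℕ) (rest col : ℕ → ℕ) (s : State) : Prop :=
  AuctionInv m adj rest col (s.mem aLabel 0) (s.mem aPrice 0) (s.mem aMate 0) (s.mem aOwner 0)

/-- The alternative in `h` is the invariant of the scan over the items: either the bidder has
already got one, which raised the potential, or all neighbours seen so far are too expensive. -/
theorem bid_runs {s : State} {i j k : ℕ} (hs : ColoredInput m adj rest col s)
    (hI : s.reg rI = i) (hJ : s.reg rJ = j) (hi : i < m) (hj : j < m) (hri : rest i = 1)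
    (hci : col i = 0) (hinv : AuctionState m adj rest col s) (hL : s.mem aLabel 0 i < m + 1)
    (h : (s.mem aMate 0 i ≠ 0 ∧ k + 1 ≤ potential m (s.mem aLabel 0) (s.mem aPrice 0)) ∨
      (s.mem aMate 0 i = 0 ∧ k ≤ potential m (s.mem aLabel 0) (s.mem aPrice 0) ∧
        ∀ b < j, IsEdge m adj rest i b → s.mem aLabel 0 i < s.mem aPrice 0 b)) :
    Runs N bid s fun s' => AuctionState m adj rest col s' ∧
      ((s'.mem aMate 0 i ≠ 0 ∧ k + 1 ≤ potential m (s'.mem aLabel 0) (s'.mem aPrice 0)) ∨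
      (s'.mem aMate 0 i = 0 ∧ k ≤ potential m (s'.mem aLabel 0) (s'.mem aPrice 0) ∧
        ∀ b < j + 1, IsEdge m adj rest i b → s'.mem aLabel 0 i < s'.mem aPrice 0 b)) := by
  refine Runs.when (fun hb => ?_) fun hb => ?_
  · simp only [Test.Holds, Expr.is, Expr.get1, Expr.eval, hI, hJ, hs.adj, hs.rest] at hb
    obtain ⟨hb1, hb2, hb3, hb4⟩ := hb
    have he : IsEdge m adj rest i j := ⟨hi, hj, hri, hb2, hb3⟩
    have hk : k ≤ potential m (s.mem aLabel 0) (s.mem aPrice 0) := by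
      rcases h with h | h
      · exact absurd hb1 h.1
      · exact h.2.1
    have hP := not_lt.1 hb4
    have fin : ∀ s' : State,
        (∀ w, s'.mem aLabel 0 w = s.mem aLabel 0 w) →
        (∀ w, s'.mem aPrice 0 w = if w = j then s.mem aLabel 0 i + 1 else s.mem aPrice 0 w) →
        (∀ w, s'.mem aOwner 0 w = if w = j then i + 1 else s.mem aOwner 0 w) →
        (∀ w, s'.mem aMate 0 w = if w = i then j + 1 else
          if w + 1 = s.mem aOwner 0 j then 0 else s.mem aMate 0 w) →
        AuctionState m adj rest col s' ∧
        ((s'.mem aMate 0 i ≠ 0 ∧ k + 1 ≤ potential m (s'.mem aLabel 0) (s'.mem aPrice 0)) ∨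
        (s'.mem aMate 0 i = 0 ∧ k ≤ potential m (s'.mem aLabel 0) (s'.mem aPrice 0) ∧
          ∀ b < j + 1, IsEdge m adj rest i b → s'.mem aLabel 0 i < s'.mem aPrice 0 b)) := by
      intro s' h1 h2 h3 h4
      have hl : s'.mem aLabel 0 = s.mem aLabel 0 := funext h1
      refine ⟨?_, Or.inl ⟨by simp [h4], ?_⟩⟩
      · rw [AuctionState, hl]
        exact hinv.assign he hci hb1 hL hP h2 h3 h4
      · rw [hl]
        refine (Nat.add_le_add_right hk 1).trans (potential_lt hj (fun _ _ => le_rfl) ?_ ?_)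
        · intro w hw
          rw [h2]
          split
          · next hwj => subst hwj; omega
          · exact le_rfl
        · rw [h2, if_pos rfl]
          omega
    refine Runs.seq (Runs.when (fun hc => Runs.store1 ?_) fun hc => ?_)
    all_goals
      refine Runs.seq (Runs.store1 (Runs.seq (Runs.store1 (Runs.store1 (fin _ ?_ ?_ ?_ ?_)))))
      all_goals
        intro w
        simp +decide [hI, hJ] at hc ⊢
        try grind
  · refine ⟨hinv, ?_⟩
    rcases h with h | ⟨h1, h2, h3⟩
    · exact Or.inl h
    · refine Or.inr ⟨h1, h2, fun b hbj he => ?_⟩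
      rcases Nat.lt_succ_iff_lt_or_eq.1 hbj with hlt | rfl
      · exact h3 b hlt he
      · by_contra hc
        refine hb ?_
        simp only [Test.Holds, Expr.is, Expr.get1, Expr.eval, hI, hJ, hs.adj, hs.rest]
        exact ⟨h1, he.2.2.2.1, he.2.2.2.2, hc⟩

/-- An active bidder always raises the potential: it obtains an item, or its label goes up. Hence a
round either gains at least one or has met inactive bidders only. -/
theorem serve_runs {s : State} {i k : ℕ} (hs : ColoredInput m adj rest col s) (hN : m ≤ N)
    (hI : s.reg rI = i) (hi : i < m) (hinv : AuctionState m adj rest col s)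
    (h : k + 1 ≤ potential m (s.mem aLabel 0) (s.mem aPrice 0) ∨
      (k ≤ potential m (s.mem aLabel 0) (s.mem aPrice 0) ∨
        ∀ a < m, ¬ IsActive m rest col (s.mem aLabel 0) (s.mem aMate 0) a) ∧
      ∀ a < i, ¬ IsActive m rest col (s.mem aLabel 0) (s.mem aMate 0) a) :
    Runs N serve s fun s' => AuctionState m adj rest col s' ∧
      (k + 1 ≤ potential m (s'.mem aLabel 0) (s'.mem aPrice 0) ∨
      (k ≤ potential m (s'.mem aLabel 0) (s'.mem aPrice 0) ∨
        ∀ a < m, ¬ IsActive m rest col (s'.mem aLabel 0) (s'.mem aMate 0) a) ∧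
      ∀ a < i + 1, ¬ IsActive m rest col (s'.mem aLabel 0) (s'.mem aMate 0) a) := by
  refine Runs.when (fun hb => ?_) fun hb => ?_
  · simp only [Test.Holds, Expr.is, Expr.get1, Expr.eval, hI, hs.col, hs.rest, hs.size] at hb
    obtain ⟨hri, hci, hb1, hb2⟩ := hb
    have hk : k ≤ potential m (s.mem aLabel 0) (s.mem aPrice 0) := by
      rcases h with h | ⟨h | h, -⟩
      · omega
      · exact h
      -- The test of `serve` says precisely that `i` is active.
      · exact absurd ⟨hri, hci, hb1, hb2⟩ (h i hi)
    refine Runs.seq (Runs.for (K := m) (fun j s' => AuctionState m adj rest col s' ∧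
      ((s'.mem aMate 0 i ≠ 0 ∧ k + 1 ≤ potential m (s'.mem aLabel 0) (s'.mem aPrice 0)) ∨
      (s'.mem aMate 0 i = 0 ∧ k ≤ potential m (s'.mem aLabel 0) (s'.mem aPrice 0) ∧
        ∀ b < j, IsEdge m adj rest i b → s'.mem aLabel 0 i < s'.mem aPrice 0 b)))
      (by decide) hN (fun s' hf => (hs.frame hf).size) ?_ ?_ ?_)
    · exact ⟨hinv, Or.inr ⟨hb1, hk, by simp⟩⟩
    · intro j s₁ hj hf₁ hr₁ h₁
      refine bid_runs (hs.frame hf₁) ((hf₁.reg _ (by decide)).trans hI) hr₁ hi hj hri hci h₁.1 ?_ h₁.2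
      rw [hf₁.mem aLabel (by decide)]
      exact hb2
    · intro s₁ hf₁ hr₁ ⟨hinv₁, h₁⟩
      have hI₁ : s₁.reg rI = i := (hf₁.reg _ (by decide)).trans hI
      have hL₁ : s₁.mem aLabel = s.mem aLabel := hf₁.mem aLabel (by decide)
      refine Runs.when (fun hc => Runs.store1 ?_) fun hc => ?_
      · simp only [Test.Holds, Expr.is, Expr.get1, Expr.eval, hI₁] at hc
        obtain ⟨-, hk₁, hp₁⟩ := h₁.resolve_left fun h => h.1 hc
        have hp₁' : ∀ b, IsEdge m adj rest i b → s₁.mem aLabel 0 i < s₁.mem aPrice 0 b :=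
          fun b he => hp₁ b he.2.1 he
        have fin : ∀ s' : State,
            (∀ w, s'.mem aLabel 0 w = if w = i then s₁.mem aLabel 0 i + 1 else s₁.mem aLabel 0 w) →
            s'.mem aPrice = s₁.mem aPrice → s'.mem aMate = s₁.mem aMate →
            s'.mem aOwner = s₁.mem aOwner → AuctionState m adj rest col s' ∧
            k + 1 ≤ potential m (s'.mem aLabel 0) (s'.mem aPrice 0) := by
          intro s' h1 h2 h3 h4
          refine ⟨?_, ?_⟩
          · rw [AuctionState, h2, h3, h4]
            exact hinv₁.raise hc hi (by rw [hL₁]; exact hb2) hp₁' h1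
          · refine (Nat.add_le_add_right hk₁ 1).trans (potential_lt hi ?_ ?_ ?_)
            · intro w hw
              rw [h1]
              split
              · next hwj => subst hwj; omega
              · exact le_rfl
            · rw [h2]
              exact fun _ _ => le_rfl
            · rw [h1, if_pos rfl, h2]
              omega
        refine (fin _ ?_ ?_ ?_ ?_).imp_right Or.inl
        · intro w
          simp [hI₁]
        all_goals exact State.setMem_mem_of_ne _ _ _ _ (by decide)
      · simp only [Test.Holds, Expr.is, Expr.get1, Expr.eval, hI₁] at hc
        exact ⟨hinv₁, Or.inl (h₁.resolve_right fun h => hc h.1).2⟩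
  · refine ⟨hinv, h.imp_right (And.imp_right fun h a ha => ?_)⟩
    rcases Nat.lt_succ_iff_lt_or_eq.1 ha with hlt | rfl
    · exact h a hlt
    · simpa [IsActive, hI, hs.col, hs.rest, hs.size] using hb

theorem initAuction_runs {s : State} (hs : ColoredInput m adj rest col s) (hN : m + 1 ≤ N) :
    Runs N initAuction s fun s' => s'.reg rRounds = (m + 1) * (2 * m + 2) ∧
      AuctionState m adj rest col s' := by
  refine Runs.seq (Runs.assign (Runs.seq ?_))
  have hs₀ : ColoredInput m adj rest col (s.setReg rRounds 0) :=
    ⟨⟨(State.setReg_reg_of_ne _ _ (by decide)).trans hs.size, hs.adj, hs.rest⟩, hs.col⟩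
  refine Runs.for (K := m + 1) (fun k s' => s'.reg rRounds = k * (2 * m + 2))
    (by decide) hN (fun s' hf => by simp [(hs₀.frame hf).size]) (by simp +decide) ?_ ?_
  · intro k s₁ hk hf₁ hr₁ h₁
    refine Runs.assign ?_
    have := (hs₀.frame hf₁).size
    simp +decide [h₁, this]
    ring
  · intro s₁ hf₁ hr₁ h₁
    have hs₁ := hs₀.frame hf₁
    refine Runs.for (K := m) (fun k s' => s'.reg rRounds = (m + 1) * (2 * m + 2) ∧
      ∀ v < k, s'.mem aLabel 0 v = 0 ∧ s'.mem aPrice 0 v = 0 ∧ s'.mem aMate 0 v = 0 ∧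
        s'.mem aOwner 0 v = 0)
      (by decide) (by omega) (fun s' hf => (hs₁.frame hf).size) (by simpa +decide using h₁) ?_ ?_
    · intro k s₂ hk hf₂ hr₂ h₂
      refine Runs.seq (Runs.store1 (Runs.seq (Runs.store1 (Runs.seq (Runs.store1
        (Runs.store1 ⟨?_, ?_⟩))))))
      · simpa +decide using h₂.1
      · intro v hv
        have := h₂.2 v
        simp +decide [hr₂]
        grind
    · intro s₂ hf₂ hr₂ ⟨h₂, h⟩
      refine ⟨h₂, ⟨fun i j he _ => ?_, fun i hi j hj => ?_, fun i j hj hij => ?_, fun i hi => ?_,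
        fun j hj _ => (h j hj).2.1, fun i hi => ?_, fun j hj => ?_⟩⟩
      · simp [(h i he.1).1]
      · simp [(h i hi).2.2.1, (h j hj).2.2.2]
      · simp [(h j hj).2.2.2] at hij
      · simp [(h i hi).2.2.1]
      · simp [(h i hi).1]
      · simp [(h j hj).2.1]

/-- After `k` rounds the potential is at least `k`, or nobody is active. There are `(m + 1) * (2 * m
+ 2)` rounds, more than the bound `m * (2 * m + 2)` for the potential. -/
theorem auction_runs {s : State} (hs : ColoredInput m adj rest col s)
    (hN : (m + 1) * (2 * m + 2) ≤ N) :
    Runs N auction s fun s' => AuctionState m adj rest col s' ∧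
      ∀ i < m, ¬ IsActive m rest col (s'.mem aLabel 0) (s'.mem aMate 0) i := by
  have hN' : m + 1 ≤ N := le_trans (by nlinarith) hN
  refine Runs.seq ((initAuction_runs hs hN').mono fun s₁ hf₁ h₁ => ?_)
  have hs₁ := hs.frame hf₁
  refine Runs.for (K := (m + 1) * (2 * m + 2)) (fun k s' => AuctionState m adj rest col s' ∧
      (k ≤ potential m (s'.mem aLabel 0) (s'.mem aPrice 0) ∨
        ∀ i < m, ¬ IsActive m rest col (s'.mem aLabel 0) (s'.mem aMate 0) i))
    (by decide) hN (fun s' hf => (hf.reg _ (by decide)).trans h₁.1) ⟨h₁.2, Or.inl (Nat.zero_le _)⟩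
    ?_ ?_
  · intro k s₂ hk hf₂ hr₂ h₂
    have hs₂ := hs₁.frame hf₂
    refine Runs.for (K := m) (fun i s' => AuctionState m adj rest col s' ∧
      (k + 1 ≤ potential m (s'.mem aLabel 0) (s'.mem aPrice 0) ∨
      (k ≤ potential m (s'.mem aLabel 0) (s'.mem aPrice 0) ∨
        ∀ a < m, ¬ IsActive m rest col (s'.mem aLabel 0) (s'.mem aMate 0) a) ∧
      ∀ a < i, ¬ IsActive m rest col (s'.mem aLabel 0) (s'.mem aMate 0) a))
      (by decide) (by omega) (fun s' hf => (hs₂.frame hf).size)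
      ⟨h₂.1, Or.inr ⟨h₂.2, by simp⟩⟩ ?_ ?_
    · intro i s₃ hi hf₃ hr₃ h₃
      exact serve_runs (hs₂.frame hf₃) (by omega) hr₃ hi h₃.1 h₃.2
    · rintro s₃ hf₃ hr₃ ⟨h₃, h⟩
      exact ⟨h₃, h.imp_right And.right⟩
  · rintro s₂ hf₂ hr₂ ⟨h₂, h⟩
    refine ⟨h₂, h.resolve_left fun hk => ?_⟩
    have := h₂.potential_le
    nlinarith

end BipartiteCover

namespace BipartiteCover

open RAM OCT

variable {m N : ℕ} {adj : ℕ → ℕ → ℕ} {rest col : ℕ → ℕ}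

/-! ### The cover -/

/-- A positive number `rLevel` that is not a price. -/
def findLevel : Cmd :=
  .assign rLevel (.num 0) ;;
  .for rI (.add (.reg rN2) (.num 1)) (
    .assign rBad (.num 0) ;;
    .for rJ (.reg rN2) (
      .when (.eq (.get1 aPrice (.reg rJ)) (.add (.reg rI) (.num 1))) (.assign rBad (.num 1))) ;;
    .when ((Expr.reg rBad).is 0) (.assign rLevel (.add (.reg rI) (.num 1))))

/-- The items with a price above `rLevel`, and the bidders whose items have a lower price. -/
def writeCover : Cmd :=
  .for rI (.reg rN2) (
    .store1 aZ (.reg rI) (.num 0) ;;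
    .when ((Expr.get1 aRest (.reg rI)).is 1) (
      .ite ((Expr.get1 aCol (.reg rI)).is 0)
        (.when (.lt (.add (.get1 aLabel (.reg rI)) (.num 1)) (.reg rLevel))
          (.store1 aZ (.reg rI) (.num 1)))
        (.when (.lt (.reg rLevel) (.get1 aPrice (.reg rI)))
          (.store1 aZ (.reg rI) (.num 1)))))

/-- A program for minimum vertex covers of bipartite graphs. -/
def minCover : Cmd :=
  coloring ;; auction ;; findLevel ;; writeCover

/-- `l` is a possible value of the register `rLevel`. -/
def IsLevel (m : ℕ) (P : ℕ → ℕ) (l : ℕ) : Prop :=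
  1 ≤ l ∧ l ≤ m + 1 ∧ ∀ j < m, P j ≠ l

/-- Pigeonhole: at most `m` prices, but `m + 1` candidates. -/
theorem exists_isLevel (m : ℕ) (P : ℕ → ℕ) : ∃ l < m + 1, ∀ j < m, P j ≠ l + 1 := by
  obtain ⟨l, hl, hP⟩ := Finset.exists_mem_notMem_of_card_lt_card
    (s := (Finset.range m).image P) (t := Finset.Icc 1 (m + 1))
    (Finset.card_image_le.trans_lt (by simp))
  rw [Finset.mem_Icc] at hl
  refine ⟨l - 1, by omega, fun j hj h => hP ?_⟩
  rw [Nat.sub_add_cancel hl.1] at h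
  exact Finset.mem_image.2 ⟨j, Finset.mem_range.2 hj, h⟩

theorem findLevel_runs {s : State} (hs : ColoredInput m adj rest col s) (hN : m + 1 ≤ N) :
    Runs N findLevel s fun s' => IsLevel m (s'.mem aPrice 0) (s'.reg rLevel) := by
  refine Runs.seq (Runs.assign ?_)
  have hs₀ : ColoredInput m adj rest col (s.setReg rLevel 0) :=
    ⟨⟨(State.setReg_reg_of_ne _ _ (by decide)).trans hs.size, hs.adj, hs.rest⟩, hs.col⟩
  -- The invariant is an implication, because `rLevel` keeps its initial value `0` until a candidate
  -- has passed.
  refine Runs.for (K := m + 1) (fun k s' => (∃ l < k, ∀ j < m, s'.mem aPrice 0 j ≠ l + 1) →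
      IsLevel m (s'.mem aPrice 0) (s'.reg rLevel))
    (by decide) hN (fun s' hf => by simp [(hs₀.frame hf).size]) (by simp) ?_ ?_
  · intro k s₁ hk hf₁ hr₁ h₁
    have hs₁ := hs₀.frame hf₁
    refine Runs.seq (Runs.assign (Runs.seq ?_))
    refine Runs.for (K := m) (fun j s' => s'.reg rBad = 0 ↔ ∀ b < j, s'.mem aPrice 0 b ≠ k + 1)
      (by decide) (by omega) (fun s' hf => ?_) (by simp +decide) ?_ ?_
    · simp +decide [hf.reg rN2 (by decide), hs₁.size]
    · intro j s₂ hj hf₂ hr₂ h₂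
      have hI₂ : s₂.reg rI = k := by simp +decide [hf₂.reg rI (by decide), hr₁]
      refine Runs.when (fun hb => Runs.assign ?_) fun hb => ?_
      · simp [hr₂, hI₂] at hb
        simp +decide
        exact ⟨j, le_rfl, hb⟩
      · simp [hr₂, hI₂] at hb
        simp +decide [h₂]
        grind
    · intro s₂ hf₂ hr₂ h₂
      have hI₂ : s₂.reg rI = k := by simp +decide [hf₂.reg rI (by decide), hr₁]
      have hL₂ : s₂.reg rLevel = s₁.reg rLevel := by simp +decide [hf₂.reg rLevel (by decide)]
      have hP₂ : s₂.mem aPrice = s₁.mem aPrice := by simp +decide [hf₂.mem aPrice (by decide)]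
      refine Runs.when (fun hb => Runs.assign ?_) fun hb => ?_
      · rintro -
        simp +decide [hI₂]
        exact ⟨by omega, by omega, h₂.1 hb⟩
      · rintro ⟨l, hl, hlP⟩
        have hlk : l ≠ k := by
          rintro rfl
          exact hb (h₂.2 hlP)
        rw [State.setReg_mem, hP₂] at hlP ⊢
        simp +decide [hL₂]
        exact h₁ ⟨l, by omega, hlP⟩
  · intro s₁ hf₁ hr₁ h₁
    exact h₁ (exists_isLevel m _)

/-- The vertex `v` is in the cover. -/
def InCover (rest col L P : ℕ → ℕ) (l v : ℕ) : Prop :=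
  rest v = 1 ∧ ((col v = 0 ∧ L v + 1 < l) ∨ (col v ≠ 0 ∧ l < P v))

theorem writeCover_runs {s : State} {l : ℕ} (hs : ColoredInput m adj rest col s) (hN : m ≤ N)
    (hl : s.reg rLevel = l) :
    Runs N writeCover s fun s' => ∀ v < m,
      (InCover rest col (s.mem aLabel 0) (s.mem aPrice 0) l v → s'.mem aZ 0 v = 1) ∧
      (¬ InCover rest col (s.mem aLabel 0) (s.mem aPrice 0) l v → s'.mem aZ 0 v = 0) := by
  refine Runs.for (K := m) (fun k s' => ∀ v < k,
      (InCover rest col (s.mem aLabel 0) (s.mem aPrice 0) l v → s'.mem aZ 0 v = 1) ∧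
      (¬ InCover rest col (s.mem aLabel 0) (s.mem aPrice 0) l v → s'.mem aZ 0 v = 0))
    (by decide) hN (fun s' hf => (hs.frame hf).size) (by simp) ?_ fun _ _ _ h => h
  intro k s₁ hk hf₁ hr₁ h₁
  have hs₁ := hs.frame hf₁
  have hl₁ : s₁.reg rLevel = l := (hf₁.reg _ (by decide)).trans hl
  have hL₁ := hf₁.mem aLabel (by decide)
  have hP₁ := hf₁.mem aPrice (by decide)
  have hrest := hs₁.rest
  have hcol := hs₁.col
  refine Runs.seq (Runs.store1 (Runs.when (fun hb => Runs.ite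
    (fun hc => Runs.when (fun hd => Runs.store1 ?_) fun hd => ?_)
    fun hc => Runs.when (fun hd => Runs.store1 ?_) fun hd => ?_) fun hb => ?_))
  all_goals
    intro v hv
    have hv' := h₁ v
    simp +decide [hr₁, hl₁, hL₁, hP₁, hrest, hcol] at *
    unfold InCover at *
    grind

/-! ### The cover is a minimum cover: König's argument. -/

/-- A set of vertices that are matched to vertices outside of the set is not larger than any vertex
cover. -/
theorem encard_le_of_isVertexCover {V : Type*} {G : SimpleGraph V} {Z C : Set V} (μ : V → V)
    (hadj : ∀ z ∈ Z, G.Adj z (μ z)) (hinj : Set.InjOn μ Z) (hμ : ∀ z ∈ Z, μ z ∉ Z)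
    (hC : G.IsVertexCover C) : Z.encard ≤ C.encard := by
  classical
  -- From each pair `z`, `μ z` an endpoint in `C` is selected. A selected `μ z` cannot coincide with
  -- a selected element of `Z`, since `μ` leaves `Z`.
  refine Set.encard_le_encard_of_injOn (f := fun z => if z ∈ C then z else μ z)
    (fun z hz => ?_) fun y hy z hz hyz => ?_
  · dsimp only
    split
    · assumption
    · exact (hC (hadj z hz)).resolve_left ‹_›
  · dsimp only at hyz
    split_ifs at hyz
    · exact hyz
    · exact absurd (hyz ▸ hy) (hμ z hz)
    · exact absurd (hyz ▸ hz) (hμ y hy)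
    · exact hinj hy hz hyz

/-- Two vertices are matched to each other at the end of the auction. -/
def IsMatched (col F O : ℕ → ℕ) (u v : ℕ) : Prop :=
  (col u = 0 ∧ F u = v + 1) ∨ (col u ≠ 0 ∧ O u = v + 1)

section Final

variable {L P F O : ℕ → ℕ} {l : ℕ}

/-- A bidder in the cover has a label below `m + 1`, so being inactive it must be matched; an item
in the cover has a positive price, so it is owned. -/
theorem InCover.exists_isMatched (h : AuctionInv m adj rest col L P F O)
    (hact : ∀ i < m, ¬ IsActive m rest col L F i) (hl : IsLevel m P l)
    (hadj : ∀ u v, IsEdge m adj rest u v → IsEdge m adj rest v u)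
    {u : ℕ} (hu : u < m) (hin : InCover rest col L P l u) :
    ∃ v, IsMatched col F O u v ∧ IsEdge m adj rest u v := by
  obtain ⟨hr, ⟨hc, hlt⟩ | ⟨hc, hlt⟩⟩ := hin
  · have hF : F u ≠ 0 := fun h0 => hact u hu ⟨hr, hc, h0, by have := hl.2.1; omega⟩
    have hle := h.mate_le u hu
    have hF' : F u = (F u - 1) + 1 := by omega
    refine ⟨F u - 1, Or.inl ⟨hc, hF'⟩, ?_⟩
    exact (h.owner u _ (by omega) ((h.mate_iff u hu _ (by omega)).1 hF')).1
  · have hO : O u ≠ 0 := fun h0 => by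
      have := h.price u hu h0
      omega
    have hO' : O u = (O u - 1) + 1 := by omega
    exact ⟨O u - 1, Or.inr ⟨hc, hO'⟩, hadj _ _ (h.owner _ u hu hO').1⟩

theorem IsMatched.symm (h : AuctionInv m adj rest col L P F O)
    (hcol : ∀ u v, IsEdge m adj rest u v → col u ≠ col v) {u v : ℕ} (he : IsEdge m adj rest u v)
    (huv : IsMatched col F O u v) : IsMatched col F O v u := by
  have hm := h.mate_iff u he.1 v he.2.1
  have hm' := h.mate_iff v he.2.1 u he.1
  have hc := hcol u v he
  rcases huv with ⟨h1, h2⟩ | ⟨h1, h2⟩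
  · exact Or.inr ⟨by omega, hm.1 h2⟩
  · exact Or.inl ⟨(h.owner v u he.1 h2).2.1, hm'.2 h2⟩

theorem IsMatched.unique {u v w : ℕ} (h : IsMatched col F O u v)
    (h' : IsMatched col F O u w) : v = w := by
  rcases h with ⟨h1, h2⟩ | ⟨h1, h2⟩ <;> rcases h' with ⟨h3, h4⟩ | ⟨h3, h4⟩ <;> omega

/-- The price `P` and label `L` of a matched pair satisfy `P = L + 1`, so `l < P` and `L + 1 < l`
exclude each other. -/
theorem InCover.not_inCover (h : AuctionInv m adj rest col L P F O)
    (hcol : ∀ u v, IsEdge m adj rest u v → col u ≠ col v) {u v : ℕ} (he : IsEdge m adj rest u v)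
    (huv : IsMatched col F O u v) (hu : InCover rest col L P l u) : ¬ InCover rest col L P l v := by
  rintro ⟨-, hv⟩
  have hc := hcol u v he
  obtain ⟨-, hu⟩ := hu
  rcases huv with ⟨h1, h2⟩ | ⟨h1, h2⟩
  · have := (h.owner u v he.2.1 ((h.mate_iff u he.1 v he.2.1).1 h2)).2.2
    omega
  · have := (h.owner v u he.1 h2).2
    omega

/-- If the item is not above the level, it is strictly below it, and so is the label of the bidder.
The bidder is then matched, and the price of its own item, its label plus one, is at most `l` and
differs from `l`. -/
theorem inCover_or_inCover (h : AuctionInv m adj rest col L P F O)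
    (hact : ∀ i < m, ¬ IsActive m rest col L F i) (hl : IsLevel m P l)
    {u v : ℕ} (he : IsEdge m adj rest u v) (hu : col u = 0) (hv : col v ≠ 0) :
    InCover rest col L P l u ∨ InCover rest col L P l v := by
  have ⟨hum, hvm, hur, hvr, _⟩ := he
  by_cases hP : l < P v
  · exact Or.inr ⟨hvr, Or.inr ⟨hv, hP⟩⟩
  · refine Or.inl ⟨hur, Or.inl ⟨hu, ?_⟩⟩
    have hne := hl.2.2 v hvm
    have hle := h.le u v he hu
    have hl1 := hl.2.1
    have hF : F u ≠ 0 := fun h0 => hact u hum ⟨hur, hu, h0, by omega⟩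
    have hFm := h.mate_le u hum
    have hF' : F u = (F u - 1) + 1 := by omega
    have := (h.owner u _ (by omega) ((h.mate_iff u hum _ (by omega)).1 hF')).2.2
    have := hl.2.2 (F u - 1) (by omega)
    omega

end Final

theorem minCover_runs {s : State} {c : ℕ → ℕ} (hs : Input m adj rest s)
    (hN : (m + 1) * (2 * m + 2) ≤ N) (hc1 : ∀ v, c v ≤ 1)
    (hc : ∀ u v, IsEdge m adj rest u v → c u ≠ c v) :
    Runs N minCover s fun s' => ∃ (col L P F O : ℕ → ℕ) (l : ℕ),
      (∀ u v, IsEdge m adj rest u v → col u ≠ col v) ∧ (∀ v < m, col v ≤ 1) ∧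
      AuctionInv m adj rest col L P F O ∧ (∀ i < m, ¬ IsActive m rest col L F i) ∧
      IsLevel m P l ∧ ∀ v < m, (InCover rest col L P l v → s'.mem aZ 0 v = 1) ∧
        (¬ InCover rest col L P l v → s'.mem aZ 0 v = 0) := by
  have hN' : m + 1 ≤ N := le_trans (by nlinarith) hN
  refine Runs.seq ((coloring_runs hs (by omega) hc1 hc).mono fun s₁ hf₁ h₁ => ?_)
  have hs₁ : ColoredInput m adj rest (s₁.mem aCol 0) s₁ := ⟨hs.frame hf₁, rfl⟩
  refine Runs.seq ((auction_runs hs₁ hN).mono fun s₂ hf₂ h₂ => ?_)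
  have hs₂ := hs₁.frame hf₂
  refine Runs.seq ((findLevel_runs hs₂ hN').mono fun s₃ hf₃ h₃ => ?_)
  have hs₃ := hs₂.frame hf₃
  refine (writeCover_runs hs₃ (by omega) rfl).mono fun s₄ hf₄ h₄ => ?_
  refine ⟨_, _, _, _, _, s₃.reg rLevel, h₁.2, h₁.1, h₂.1, h₂.2, ?_, ?_⟩
  · rwa [← hf₃.mem aPrice (by decide)]
  · rwa [← hf₃.mem aPrice (by decide), ← hf₃.mem aLabel (by decide)]

theorem minCover_isBipartiteVertexCoverRoutine : IsBipartiteVertexCoverRoutine minCover := by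
  classical
  -- The number of rounds of the auction bounds the length of every loop.
  refine ⟨minCover.timePoly.comp ((Polynomial.X + 1) * (2 * Polynomial.X + 2)), ?_⟩
  intro m G U s hbip hm hG hU
  obtain ⟨c⟩ := hbip
  have hedge : ∀ u v : Fin m, IsEdge m (s.mem aSq) (s.mem aRest 0) u v ↔
      u ∈ U ∧ v ∈ U ∧ G.Adj u v := by
    intro u v
    have h1 := hU u
    have h2 := hU v
    have h3 := hG u v
    have hu := u.2
    have hv := v.2
    unfold IsEdge
    grind
  -- The value `0` outside of `U` is arbitrary: only endpoints of edges of `G[U]` matter.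
  set c' : ℕ → ℕ := fun v => if h : ∃ hv : v < m, (⟨v, hv⟩ : Fin m) ∈ U then
    (c ⟨⟨v, h.1⟩, h.2⟩ : ℕ) else 0 with hc'
  have hc1 : ∀ v, c' v ≤ 1 := by
    intro v
    simp only [hc']
    split
    · exact Nat.lt_succ_iff.1 (Fin.is_lt _)
    · exact Nat.zero_le _
  have hc2 : ∀ u v, IsEdge m (s.mem aSq) (s.mem aRest 0) u v → c' u ≠ c' v := by
    intro u v he
    obtain ⟨hu, hv, ha⟩ := (hedge ⟨u, he.1⟩ ⟨v, he.2.1⟩).1 he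
    simp only [hc']
    rw [dif_pos ⟨he.1, hu⟩, dif_pos ⟨he.2.1, hv⟩]
    intro h
    exact c.valid (v := ⟨⟨u, he.1⟩, hu⟩) (w := ⟨⟨v, he.2.1⟩, hv⟩) ha (Fin.ext h)
  obtain ⟨t, s', hexec, ht, col, L, P, F, O, l, hcol, hcol1, hinv, hact, hl, hZ⟩ :=
    minCover_runs (N := (m + 1) * (2 * m + 2)) ⟨hm, rfl, rfl⟩ le_rfl hc1 hc2
  have hf := hexec.frame
  refine ⟨t, s', hexec, ?_, ?_, fun x hx => hf.reg x ?_, fun a ha hne => hf.mem a ?_⟩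
  · simpa [Polynomial.eval_comp] using ht
  · have hcovU : ∀ v : Fin m, InCover (s.mem aRest 0) col L P l v → v ∈ U := by
      intro v hv
      by_contra h
      have := hv.1
      rw [(hU v).2 h] at this
      exact zero_ne_one this
    have hsymm : ∀ u v, IsEdge m (s.mem aSq) (s.mem aRest 0) u v →
        IsEdge m (s.mem aSq) (s.mem aRest 0) v u := by
      intro u v he
      have := (hedge ⟨u, he.1⟩ ⟨v, he.2.1⟩).1 he
      exact (hedge ⟨v, he.2.1⟩ ⟨u, he.1⟩).2 ⟨this.2.1, this.1, this.2.2.symm⟩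
    set Z : Set U := {v | InCover (s.mem aRest 0) col L P l (v : Fin m)} with hZdef
    have hcover : (G.induce U).IsVertexCover Z := by
      intro u v huv
      have he := (hedge u v).2 ⟨u.2, v.2, huv⟩
      have hne := hcol _ _ he
      by_cases hu : col (u : Fin m) = 0
      · exact inCover_or_inCover hinv hact hl he hu (by omega)
      · have h1 := hcol1 _ he.1
        have h2 := hcol1 _ he.2.1
        exact (inCover_or_inCover hinv hact hl (hsymm _ _ he) (by omega) hu).symm
    refine ⟨Z, hcover, le_antisymm ?_ hcover.vertexCoverNum_le, ?_⟩
    · obtain ⟨C, hC, hCcov⟩ := (G.induce U).vertexCoverNum_exists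
      rw [← hC]
      have hmatch : ∀ z : U, ∃ w : U, z ∈ Z →
          IsMatched col F O (z : Fin m) (w : Fin m) ∧
          IsEdge m (s.mem aSq) (s.mem aRest 0) (z : Fin m) (w : Fin m) := by
        intro z
        by_cases hz : z ∈ Z
        · obtain ⟨w, hw, he⟩ := InCover.exists_isMatched hinv hact hl hsymm z.1.2 hz
          exact ⟨⟨⟨w, he.2.1⟩, ((hedge z ⟨w, he.2.1⟩).1 he).2.1⟩, fun _ => ⟨hw, he⟩⟩
        · exact ⟨z, fun h => absurd h hz⟩
      choose μ hμ using hmatch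
      refine encard_le_of_isVertexCover μ (fun z hz => ?_) (fun y hy z hz hyz => ?_)
        (fun z hz => ?_) hCcov
      · exact ((hedge _ _).1 (hμ z hz).2).2.2
      · obtain ⟨hy1, hy2⟩ := hμ y hy
        obtain ⟨hz1, hz2⟩ := hμ z hz
        rw [← hyz] at hz1 hz2
        -- Two vertices with the same mate are both mates of that vertex, and a vertex has only one.
        exact Subtype.ext (Fin.ext
          ((hy1.symm hinv hcol hy2).unique (hz1.symm hinv hcol hz2)))
      · exact InCover.not_inCover hinv hcol (hμ z hz).2 (hμ z hz).1 hz
    · intro v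
      refine ⟨?_, fun hv => (hZ v v.2).2 fun h => hv ⟨⟨v, hcovU v h⟩, h, rfl⟩⟩
      rintro ⟨w, hw, rfl⟩
      exact (hZ _ w.1.2).1 hw
  · revert x
    decide
  · revert a
    decide

end BipartiteCover

namespace OCT

/-! ### The graph `H²` -/

/-- The graph `H²`, with two copies of every vertex. -/
def doubled {V : Type*} (H : SimpleGraph V) : SimpleGraph (V ⊕ V) where
  Adj
    | .inl u, .inl v => H.Adj u v
    | .inr u, .inr v => H.Adj u v
    | .inl u, .inr v => u = v
    | .inr u, .inl v => u = v
  symm := ⟨by rintro (u | u) (v | v) h <;> first | exact H.symm h | exact h.symm⟩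
  loopless := ⟨by rintro (u | u) <;> exact H.irrefl⟩

variable {n : ℕ}

/-- The graph `H²` on the numbers of its vertices. -/
def square (H : SimpleGraph (Fin n)) : SimpleGraph (Fin (n + n)) :=
  (doubled H).comap finSumFinEquiv.symm

/-- The number of the vertex `v₁`. -/
def copy₁ (v : Fin n) : Fin (n + n) := v.castAdd n

/-- The number of the vertex `v₂`. -/
def copy₂ (v : Fin n) : Fin (n + n) := v.natAdd n

@[simp] theorem copy₁_val (v : Fin n) : (copy₁ v : ℕ) = v := rfl

@[simp] theorem copy₂_val (v : Fin n) : (copy₂ v : ℕ) = n + v := rfl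

theorem copy₁_injective : Function.Injective (copy₁ : Fin n → Fin (n + n)) :=
  Fin.castAdd_injective n n

theorem copy₂_injective : Function.Injective (copy₂ : Fin n → Fin (n + n)) :=
  Fin.natAdd_injective n n

@[simp] theorem finSumFinEquiv_symm_copy₁ (v : Fin n) :
    finSumFinEquiv.symm (copy₁ v) = .inl v := finSumFinEquiv_symm_apply_castAdd v

@[simp] theorem finSumFinEquiv_symm_copy₂ (v : Fin n) :
    finSumFinEquiv.symm (copy₂ v) = .inr v := finSumFinEquiv_symm_apply_natAdd v

/-- The set `A₁ ∪ B₂`. -/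
def lift (A B : Set (Fin n)) : Set (Fin (n + n)) :=
  {a | Sum.elim (· ∈ A) (· ∈ B) (finSumFinEquiv.symm a)}

section square

variable {H : SimpleGraph (Fin n)} {u v : Fin n} {A B : Set (Fin n)}

@[simp] theorem square_adj_left : (square H).Adj (copy₁ u) (copy₁ v) ↔ H.Adj u v := by
  simp [square, doubled]

@[simp] theorem square_adj_right : (square H).Adj (copy₂ u) (copy₂ v) ↔ H.Adj u v := by
  simp [square, doubled]

@[simp] theorem square_adj_left_right : (square H).Adj (copy₁ u) (copy₂ v) ↔ u = v := by
  simp [square, doubled]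

@[simp] theorem square_adj_right_left : (square H).Adj (copy₂ u) (copy₁ v) ↔ u = v := by
  simp [square, doubled]

@[simp] theorem copy₁_mem_lift : copy₁ u ∈ lift A B ↔ u ∈ A := by
  simp [lift]

@[simp] theorem copy₂_mem_lift : copy₂ u ∈ lift A B ↔ u ∈ B := by
  simp [lift]

theorem forall_copies {P : Fin (n + n) → Prop} :
    (∀ a, P a) ↔ (∀ v : Fin n, P (copy₁ v)) ∧ ∀ v : Fin n, P (copy₂ v) :=
  ⟨fun h => ⟨fun _ => h _, fun _ => h _⟩, fun h a => Fin.addCases h.1 h.2 a⟩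

end square

/-- The vertices of which both copies are in `X`. -/
def bothCopies (X : Set (Fin (n + n))) : Set (Fin n) :=
  {v | copy₁ v ∈ X ∧ copy₂ v ∈ X}

/-- The edges `v₁v₂` force at least one copy of each vertex into `X`; the second copies are counted
by inclusion and exclusion. -/
theorem ncard_eq_add_ncard_bothCopies {H : SimpleGraph (Fin n)} {X : Set (Fin (n + n))}
    (hX : (square H).IsVertexCover X) : X.ncard = n + (bothCopies X).ncard := by
  set A : Set (Fin n) := copy₁ ⁻¹' X
  set B : Set (Fin n) := copy₂ ⁻¹' X
  have hu : A ∪ B = Set.univ := by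
    ext v
    simpa [A, B] using hX (v := copy₁ v) (w := copy₂ v) (by simp)
  have hXAB : X = copy₁ '' A ∪ copy₂ '' B := by
    ext a
    revert a
    rw [forall_copies]
    refine ⟨fun v => ⟨fun h => Or.inl ⟨v, h, rfl⟩, ?_⟩, fun v => ⟨fun h => Or.inr ⟨v, h, rfl⟩, ?_⟩⟩ <;>
    · rintro (⟨w, hw, h⟩ | ⟨w, hw, h⟩) <;> exact h ▸ hw
  have hd : Disjoint (copy₁ '' A) (copy₂ '' B) := by
    rw [Set.disjoint_left]
    rintro _ ⟨v, -, rfl⟩ ⟨w, -, h⟩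
    have := congrArg Fin.val h
    simp at this
    omega
  rw [hXAB, Set.ncard_union_eq hd, ← hXAB,
    Set.ncard_image_of_injective _ copy₁_injective,
    Set.ncard_image_of_injective _ copy₂_injective,
    ← Set.ncard_union_add_ncard_inter A B, hu, Set.ncard_univ, Nat.card_fin]
  rfl

/-! ### Colourings -/

theorem isBipartite_iff_exists {V : Type*} {G : SimpleGraph V} :
    G.IsBipartite ↔ ∃ S : Set V, ∀ u v, G.Adj u v → (u ∈ S ↔ v ∉ S) := by
  classical
  constructor
  · rintro ⟨c⟩
    refine ⟨{v | c v = 0}, fun u v h => ?_⟩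
    have := c.valid h
    simp only [Set.mem_ofPred_eq]
    omega
  · rintro ⟨S, hS⟩
    refine ⟨.mk (fun v => if v ∈ S then 0 else 1) fun {u v} h => ?_⟩
    have := hS u v h
    by_cases hu : u ∈ S <;> by_cases hv : v ∈ S <;> simp_all

theorem isOCT_iff_exists {V : Type*} {G : SimpleGraph V} {T : Finset V} :
    IsOCT G T ↔ ∃ S : Set V, ∀ u v, G.Adj u v → u ∉ T → v ∉ T → (u ∈ S ↔ v ∉ S) := by
  rw [IsOCT, isBipartite_iff_exists]
  constructor
  · rintro ⟨S, hS⟩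
    refine ⟨Subtype.val '' S, fun u v h hu hv => ?_⟩
    have := hS ⟨u, by simpa using hu⟩ ⟨v, by simpa using hv⟩ h
    simpa [hu, hv] using this
  · rintro ⟨S, hS⟩
    exact ⟨Subtype.val ⁻¹' S, fun u v h => hS u v h u.2 v.2⟩

/-! ### The choices of `Y` -/

variable {H : SimpleGraph (Fin n)} {T : Finset (Fin n)} {D : Set (Fin n)}

/-- The set `Y` that contains `v₁` for `v ∈ T ∩ D` and `v₂` for `v ∈ T \ D`. -/
def choice (T : Finset (Fin n)) (D : Set (Fin n)) : Set (Fin (n + n)) :=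
  lift (T ∩ D) (T \ D)

/-- The set `T₁ ∪ T₂`. -/
def copies (T : Finset (Fin n)) : Set (Fin (n + n)) := lift T T

/-- `Y` is a vertex cover of `G[A]`. -/
def CoversOn {m : ℕ} (G : SimpleGraph (Fin m)) (A Y : Set (Fin m)) : Prop :=
  ∀ a b, a ∈ A → b ∈ A → G.Adj a b → a ∈ Y ∨ b ∈ Y

/-- The vertices outside of `A` that are adjacent to some vertex of `A \ Y`. -/
def forced {m : ℕ} (G : SimpleGraph (Fin m)) (A Y : Set (Fin m)) : Set (Fin m) :=
  {a | a ∉ A ∧ ∃ b ∈ A, b ∉ Y ∧ G.Adj a b}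

/-- The other vertices outside of `A`. -/
def remaining {m : ℕ} (G : SimpleGraph (Fin m)) (A Y : Set (Fin m)) : Set (Fin m) :=
  {a | a ∉ A ∧ a ∉ forced G A Y}

/-- There is a smaller odd cycle transversal `T'` disjoint from `T`, and a proper 2-colouring of
`H - T'` that colours `T` as prescribed by `D`. -/
def HasCompression (H : SimpleGraph (Fin n)) (T : Finset (Fin n)) (D : Set (Fin n)) : Prop :=
  ∃ T', IsDisjointCompression H T T' ∧ ∃ S : Set (Fin n),
    (∀ u v, H.Adj u v → u ∉ T' → v ∉ T' → (u ∈ S ↔ v ∉ S)) ∧ ∀ v ∈ T, v ∈ S ↔ v ∈ D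

/-- A colour class of `H - T'` itself serves as the prescription `D`. -/
theorem exists_hasCompression {T' : Finset (Fin n)} (h : IsDisjointCompression H T T') :
    ∃ D, HasCompression H T D := by
  obtain ⟨S, hS⟩ := isOCT_iff_exists.1 h.1
  exact ⟨S, T', h, S, hS, fun _ _ => Iff.rfl⟩

theorem HasCompression.congr {D' : Set (Fin n)} (h : HasCompression H T D)
    (hD : ∀ v ∈ T, v ∈ D ↔ v ∈ D') : HasCompression H T D' := by
  obtain ⟨T', h', S, hS, hSD⟩ := h
  exact ⟨T', h', S, hS, fun v hv => (hSD v hv).trans (hD v hv)⟩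

/-- A 2-colouring of `H - T` is used on the first copy and its opposite on the second, so the edges
`v₁v₂` are properly coloured too. -/
theorem isBipartite_remaining (hT : IsOCT H T) (Y : Set (Fin (n + n))) :
    ((square H).induce (remaining (square H) (copies T) Y)).IsBipartite := by
  obtain ⟨S, hS⟩ := isOCT_iff_exists.1 hT
  have key : ∀ a b, (square H).Adj a b → a ∉ copies T → b ∉ copies T →
      (a ∈ lift S Sᶜ ↔ b ∉ lift S Sᶜ) := by
    simp only [forall_copies, copies]
    simp
    grind
  exact isBipartite_iff_exists.2 ⟨Subtype.val ⁻¹' lift S Sᶜ, fun a b h => key a b h a.2.1 b.2.1⟩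

/-- The vertex cover of `H²` that belongs to `T'` and to a 2-colouring of `H - T'`. -/
theorem isVertexCover_lift {T' S : Set (Fin n)}
    (hS : ∀ u v, H.Adj u v → u ∉ T' → v ∉ T' → (u ∈ S ↔ v ∉ S)) :
    (square H).IsVertexCover (lift (T' ∪ S) (T' ∪ Sᶜ)) := by
  have key : ∀ a b, (square H).Adj a b →
      a ∈ lift (T' ∪ S) (T' ∪ Sᶜ) ∨ b ∈ lift (T' ∪ S) (T' ∪ Sᶜ) := by
    simp only [forall_copies]
    simp
    grind
  exact key

theorem bothCopies_lift (T' S : Set (Fin n)) : bothCopies (lift (T' ∪ S) (T' ∪ Sᶜ)) = T' := by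
  ext v
  simp [bothCopies]
  tauto

theorem mem_lift_iff_mem_choice {T' : Finset (Fin n)} {S : Set (Fin n)} (hT : Disjoint T T')
    (hD : ∀ v ∈ T, v ∈ S ↔ v ∈ D) : ∀ a ∈ copies T,
    (a ∈ lift (T' ∪ S) (T' ∪ Sᶜ) ↔ a ∈ choice T D) := by
  have := Finset.disjoint_left.1 hT
  rw [forall_copies]
  simp [copies, choice]
  grind

/-- The choice `Y` is the trace on `T₁ ∪ T₂` of a vertex cover of `H²`, so a successful choice is
never discarded by the test. -/
theorem HasCompression.coversOn (h : HasCompression H T D) :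
    CoversOn (square H) (copies T) (choice T D) := by
  obtain ⟨T', ⟨-, -, hd⟩, S, hS, hSD⟩ := h
  intro a b ha hb hab
  rw [← mem_lift_iff_mem_choice hd hSD a ha, ← mem_lift_iff_mem_choice hd hSD b hb]
  exact isVertexCover_lift (by simpa using hS) hab

/-! ### The cover that belongs to a choice, and its optimality. -/

section Cover

variable {Z : Set (remaining (square H) (copies T) (choice T D))}

/-- The set `X = Y ∪ W ∪ Z`. -/
def cover (T : Finset (Fin n)) (D : Set (Fin n))
    (Z : Set (remaining (square H) (copies T) (choice T D))) : Set (Fin (n + n)) :=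
  choice T D ∪ forced (square H) (copies T) (choice T D) ∪ Subtype.val '' Z

theorem isVertexCover_cover (hD : CoversOn (square H) (copies T) (choice T D))
    (hZ : ((square H).induce (remaining (square H) (copies T) (choice T D))).IsVertexCover Z) :
    (square H).IsVertexCover (cover T D Z) := by
  have hforced : ∀ a b, (square H).Adj a b → a ∈ copies T → b ∉ copies T →
      a ∈ cover T D Z ∨ b ∈ cover T D Z := by
    intro a b hab ha hb
    by_cases haY : a ∈ choice T D
    · exact Or.inl (Or.inl (Or.inl haY))
    · exact Or.inr (Or.inl (Or.inr ⟨hb, a, ha, haY, hab.symm⟩))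
  intro a b hab
  by_cases ha : a ∈ copies T <;> by_cases hb : b ∈ copies T
  · exact (hD a b ha hb hab).imp (fun h => Or.inl (Or.inl h)) fun h => Or.inl (Or.inl h)
  · exact hforced a b hab ha hb
  · exact (hforced b a hab.symm hb ha).symm
  · by_cases haW : a ∈ forced (square H) (copies T) (choice T D)
    · exact Or.inl (Or.inl (Or.inr haW))
    by_cases hbW : b ∈ forced (square H) (copies T) (choice T D)
    · exact Or.inr (Or.inl (Or.inr hbW))
    exact (hZ (v := ⟨a, ha, haW⟩) (w := ⟨b, hb, hbW⟩) hab).imp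
      (fun h => Or.inr ⟨_, h, rfl⟩) fun h => Or.inr ⟨_, h, rfl⟩

theorem mem_cover_iff_mem_choice {a : Fin (n + n)} (ha : a ∈ copies T) :
    a ∈ cover T D Z ↔ a ∈ choice T D := by
  refine ⟨?_, fun h => Or.inl (Or.inl h)⟩
  rintro ((h | h) | ⟨b, -, rfl⟩)
  · exact h
  · exact absurd ha h.1
  · exact absurd ha b.2.1

theorem disjoint_bothCopies_cover {v : Fin n} (hv : v ∈ T) : v ∉ bothCopies (cover T D Z) := by
  rintro ⟨h1, h2⟩
  rw [mem_cover_iff_mem_choice (by simpa [copies] using hv)] at h1 h2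
  simp [choice] at h1 h2
  exact h2.2 h1.2

/-- If neither `u₁` nor `v₁` were in `X`, the edge `u₁v₁` would be uncovered; if both were, then
neither `u₂` nor `v₂` would be, and `u₂v₂` would be uncovered. -/
theorem colouring_of_isVertexCover {X : Set (Fin (n + n))} (hX : (square H).IsVertexCover X)
    (u v : Fin n) (huv : H.Adj u v) (hu : u ∉ bothCopies X) (hv : v ∉ bothCopies X) :
    copy₁ u ∈ X ↔ copy₁ v ∉ X := by
  have h1 := hX (square_adj_left.2 huv)
  have h2 := hX (square_adj_right.2 huv)
  have h3 : copy₁ u ∈ X ∨ copy₂ u ∈ X := hX (square_adj_left_right.2 rfl)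
  have h4 : copy₁ v ∈ X ∨ copy₂ v ∈ X := hX (square_adj_left_right.2 rfl)
  simp only [bothCopies, Set.mem_ofPred_eq] at hu hv
  tauto

/-- Let `X` be the cover given by the compression and its colouring. It has the trace `Y`, so it
contains `W`, and it covers the remaining graph with at least `|Z|` vertices. Hence `|Y ∪ W ∪ Z| ≤
|X|`, and subtracting `n` compares the two transversals. -/
theorem HasCompression.ncard_lt (h : HasCompression H T D)
    (hZ : ((square H).induce (remaining (square H) (copies T) (choice T D))).IsVertexCover Z)
    (hZmin : Z.encard =
      ((square H).induce (remaining (square H) (copies T) (choice T D))).vertexCoverNum) :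
    (bothCopies (cover T D Z)).ncard < T.card := by
  have hcov := ncard_eq_add_ncard_bothCopies (isVertexCover_cover h.coversOn hZ)
  obtain ⟨T', ⟨-, hcard, hd⟩, S, hS, hSD⟩ := h
  have hmem := mem_lift_iff_mem_choice hd hSD
  have hXcov : (square H).IsVertexCover (lift (T' ∪ S) (T' ∪ Sᶜ)) :=
    isVertexCover_lift (by simpa using hS)
  have hX := ncard_eq_add_ncard_bothCopies hXcov
  rw [bothCopies_lift, Set.ncard_coe_finset] at hX
  set X := lift (T' ∪ S) (T' ∪ Sᶜ)
  have h1 : Z.ncard ≤ (X ∩ remaining (square H) (copies T) (choice T D)).ncard := by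
    have hle : Z.encard ≤
        (Subtype.val ⁻¹' X : Set (remaining (square H) (copies T) (choice T D))).encard := by
      rw [hZmin]
      exact SimpleGraph.IsVertexCover.vertexCoverNum_le fun a b hab => hXcov hab
    have := ENat.toNat_le_toNat hle (Set.encard_ne_top_iff.2 (Set.toFinite _))
    refine this.trans (le_of_eq ?_)
    change (Subtype.val ⁻¹' X : Set (remaining (square H) (copies T) (choice T D))).ncard = _
    rw [← Set.ncard_image_of_injective _ Subtype.val_injective, Subtype.image_preimage_coe,
      Set.inter_comm]
  have h2 : (choice T D ∪ forced (square H) (copies T) (choice T D)).ncard ≤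
      (X \ remaining (square H) (copies T) (choice T D)).ncard := by
    refine Set.ncard_le_ncard ?_ (Set.toFinite _)
    rintro a (ha | ha)
    · have haT : a ∈ copies T := by
        revert a
        rw [forall_copies]
        simp [choice, copies]
        tauto
      exact ⟨(hmem a haT).2 ha, fun h => h.1 haT⟩
    · refine ⟨?_, fun h => h.2 ha⟩
      obtain ⟨-, b, hb, hbY, hab⟩ := ha
      exact (hXcov hab).resolve_right fun h => hbY ((hmem b hb).1 h)
  have h3 := Set.ncard_inter_add_ncard_sdiff_eq_ncard X
    (remaining (square H) (copies T) (choice T D)) (Set.toFinite _)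
  have h4 : (cover T D Z).ncard ≤ _ := Set.ncard_union_le _ _
  rw [Set.ncard_image_of_injective _ Subtype.val_injective] at h4
  omega

end Cover

end OCT

namespace OCT

open RAM

variable {n m N : ℕ} {s s' : State}

theorem HoldsSet.eq_one_iff {a : ℕ} {S : Set (Fin m)} (h : HoldsSet s a S) (v : Fin m) :
    s.mem a 0 v = 1 ↔ v ∈ S := by
  have := h v
  grind

theorem HoldsSet.eq_zero_iff {a : ℕ} {S : Set (Fin m)} (h : HoldsSet s a S) (v : Fin m) :
    s.mem a 0 v = 0 ↔ v ∉ S := by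
  have := h v
  grind

theorem HoldsGraph.eq_one_iff {a : ℕ} {G : SimpleGraph (Fin m)} (h : HoldsGraph s a G)
    (u v : Fin m) : s.mem a u v = 1 ↔ G.Adj u v := by
  have := h u v
  grind

theorem HoldsSet.of_mem_eq {a : ℕ} {S : Set (Fin m)} (h : HoldsSet s a S)
    (he : s'.mem a = s.mem a) : HoldsSet s' a S := by
  simpa only [HoldsSet, he] using h

theorem HoldsGraph.of_mem_eq {a : ℕ} {G : SimpleGraph (Fin m)} (h : HoldsGraph s a G)
    (he : s'.mem a = s.mem a) : HoldsGraph s' a G := by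
  simpa only [HoldsGraph, he] using h

/-! ### The construction of `H²` -/

/-- The entries of the adjacency matrix `M` of `H²` for the pairs in `D` have been written. -/
def SquareInv (n : ℕ) (adj M : ℕ → ℕ → ℕ) (D : ℕ → ℕ → Prop) : Prop :=
  ∀ i < n, ∀ j < n,
    (D i j → M i j = adj i j ∧ M (n + i) (n + j) = adj i j) ∧
    (i = j → D i j → M i (n + j) = 1 ∧ M (n + i) j = 1) ∧
    (i ≠ j → M i (n + j) = 0 ∧ M (n + i) j = 0)

theorem SquareInv.mono {adj M : ℕ → ℕ → ℕ} {D D' : ℕ → ℕ → Prop} (h : SquareInv n adj M D)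
    (hD : ∀ i < n, ∀ j < n, D' i j → D i j) : SquareInv n adj M D' :=
  fun i hi j hj => ⟨fun hd => (h i hi j hj).1 (hD i hi j hj hd),
    fun he hd => (h i hi j hj).2.1 he (hD i hi j hj hd), (h i hi j hj).2.2⟩

theorem buildSquare_runs {H : SimpleGraph (Fin n)} (hn : s.reg rN = n) (hN : n ≤ N)
    (hH : HoldsGraph s aAdj H) (h0 : ∀ i j, s.mem aSq i j = 0) :
    Runs N buildSquare s fun s' => s'.reg rN2 = n + n ∧ HoldsGraph s' aSq (square H) := by
  refine Runs.seq (Runs.assign ?_)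
  -- The entries for `u₁v₂` with `u ≠ v` are never written; they are right because the array is `0`
  -- at the start.
  refine Runs.for (K := n) (fun k s' => SquareInv n (s.mem aAdj) (s'.mem aSq) fun i _ => i < k)
    (by decide) hN (fun s' hf => ?_) ?_ ?_ ?_
  · simp +decide [hf.reg rN (by decide), hn]
  · intro i _ j _
    simp [h0]
  · intro k s₁ hk hf₁ hr₁ h₁
    have hn₁ : s₁.reg rN = n := by simp +decide [hf₁.reg rN (by decide), hn]
    refine Runs.for (K := n) (fun l s' => SquareInv n (s.mem aAdj) (s'.mem aSq)
        fun i j => i < k ∨ (i = k ∧ j < l))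
      (by decide) hN (fun s' hf => (hf.reg rN (by decide)).trans hn₁) (h₁.mono (by simp)) ?_ ?_
    · intro l s₂ hl hf₂ hr₂ h₂
      have hn₂ : s₂.reg rN = n := (hf₂.reg rN (by decide)).trans hn₁
      have hU₂ : s₂.reg rU = k := (hf₂.reg rU (by decide)).trans hr₁
      have hA₂ : s₂.mem aAdj = s.mem aAdj :=
        (hf₂.mem aAdj (by decide)).trans (hf₁.mem aAdj (by decide))
      refine Runs.seq (Runs.store (Runs.seq (Runs.store (Runs.when
        (fun hb => Runs.seq (Runs.store (Runs.store ?_))) fun hb => ?_))))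
      all_goals
        simp [hU₂, hr₂] at hb
        intro i hi j hj
        have := h₂ i hi j hj
        have n1 : i ≠ n + k := by omega
        have n2 : j ≠ n + l := by omega
        have n3 : n + i ≠ k := by omega
        have n4 : n + j ≠ l := by omega
        simp +decide [hU₂, hr₂, hn₂, hA₂, n1, n2, n3, n4]
        grind
    · intro s₂ hf₂ hr₂ h₂
      refine h₂.mono fun i hi j hj (h : i < k + 1) => ?_
      omega
  · intro s₁ hf₁ hr₁ h₁
    refine ⟨by simp +decide [hf₁.reg rN2 (by decide), hn], ?_⟩
    rw [HoldsGraph]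
    simp only [forall_copies, copy₁_val, copy₂_val, square_adj_left, square_adj_right,
      square_adj_left_right, square_adj_right_left]
    have key := fun u v : Fin n => h₁ u u.2 v v.2
    have hH' := fun u v : Fin n => hH u v
    simp only [ne_eq, Fin.val_inj] at key
    refine ⟨fun u => ⟨fun v => ?_, fun v => ?_⟩, fun u => ⟨fun v => ?_, fun v => ?_⟩⟩
    all_goals
      have := key u v
      have := hH' u v
      have := u.2
      grind

/-! ### The number of elements below a bound -/

/-- The number of elements of `S` that are less than `k`. -/
noncomputable def countBelow (S : Set (Fin n)) (k : ℕ) : ℕ := (S ∩ {v | (v : ℕ) < k}).ncard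

open Classical in
theorem countBelow_succ (S : Set (Fin n)) (v : Fin n) :
    countBelow S (v + 1) = countBelow S v + if v ∈ S then 1 else 0 := by
  unfold countBelow
  split
  · next hv =>
    rw [← Set.ncard_insert_of_notMem (a := v) (by simp) (Set.toFinite _)]
    congr 1
    ext w
    simp only [Set.mem_inter_iff, Set.mem_ofPred_eq, Set.mem_insert_iff, Nat.lt_succ_iff_lt_or_eq,
      Fin.val_inj]
    grind
  · next hv =>
    rw [add_zero]
    congr 1
    ext w
    simp only [Set.mem_inter_iff, Set.mem_ofPred_eq, Nat.lt_succ_iff_lt_or_eq, Fin.val_inj]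
    grind

theorem countBelow_zero (S : Set (Fin n)) : countBelow S 0 = 0 := by
  simp [countBelow]

theorem countBelow_self (S : Set (Fin n)) : countBelow S n = S.ncard := by
  simp [countBelow]

/-! ### The steps of the algorithm -/

theorem initChoice_runs {T : Finset (Fin n)} (hn : s.reg rN = n) (hN : n ≤ N)
    (hT : HoldsSet s aT (T : Set (Fin n))) :
    Runs N initChoice s fun s' => s'.reg rK = T.card ∧ HoldsSet s' aTT (copies T) ∧
      HoldsSet s' aY (choice T Set.univ) := by
  refine Runs.seq (Runs.assign ?_)
  refine Runs.for (K := n) (fun k s' => s'.reg rK = countBelow (T : Set (Fin n)) k ∧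
      ∀ v : Fin n, v < k → s'.mem aTT 0 v = s.mem aT 0 v ∧ s'.mem aTT 0 (n + v) = s.mem aT 0 v ∧
        s'.mem aY 0 v = s.mem aT 0 v ∧ s'.mem aY 0 (n + v) = 0)
    (by decide) hN (fun s' hf => ?_) (by simp +decide [countBelow_zero]) ?_ ?_
  · simp +decide [hf.reg rN (by decide), hn]
  · rintro k s₁ hk hf₁ hr₁ ⟨h₁, h⟩
    have hn₁ : s₁.reg rN = n := by simp +decide [hf₁.reg rN (by decide), hn]
    have hT₁ : s₁.mem aT = s.mem aT := hf₁.mem aT (by decide)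
    refine Runs.seq (Runs.assign (Runs.seq (Runs.store1 (Runs.seq (Runs.store1 (Runs.seq
      (Runs.store1 (Runs.store1 ⟨?_, fun v hv => ?_⟩))))))))
    · have hc := countBelow_succ (T : Set (Fin n)) ⟨k, hk⟩
      have hTk := hT ⟨k, hk⟩
      simp +decide [hr₁, hT₁, h₁]
      simp at hc hTk
      grind
    · have := h v
      have := v.2
      simp +decide [hr₁, hn₁, hT₁]
      grind
  · rintro s₁ hf₁ hr₁ ⟨h₁, h⟩
    refine ⟨by rw [h₁, countBelow_self, Set.ncard_coe_finset], ?_, ?_⟩ <;>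
      rw [HoldsSet, forall_copies]
    all_goals
      refine ⟨fun v => ?_, fun v => ?_⟩
      all_goals
        have h1 := h v v.2
        have h2 := hT v
        simp only [copy₁_val, copy₂_val, copies, choice, copy₁_mem_lift, copy₂_mem_lift, h1,
          Set.inter_univ, Set.sdiff_univ, Set.mem_empty_iff_false]
        first | exact h2 | simp

theorem checkChoice_runs {G : SimpleGraph (Fin m)} {A Y : Set (Fin m)} (hm : s.reg rN2 = m)
    (hN : m ≤ N) (hG : HoldsGraph s aSq G) (hA : HoldsSet s aTT A) (hY : HoldsSet s aY Y) :
    Runs N checkChoice s fun s' => s'.reg rValid = 1 ↔ CoversOn G A Y := by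
  refine Runs.seq (Runs.assign ?_)
  refine Runs.for (K := m) (fun k s' => s'.reg rValid = 1 ↔ ∀ a b : Fin m, a < k →
      (a ∈ A → b ∈ A → G.Adj a b → a ∈ Y ∨ b ∈ Y))
    (by decide) hN (fun s' hf => ?_) (by simp +decide) ?_ ?_
  · simp +decide [hf.reg rN2 (by decide), hm]
  · intro k s₁ hk hf₁ hr₁ h₁
    have hm₁ : s₁.reg rN2 = m := by simp +decide [hf₁.reg rN2 (by decide), hm]
    refine Runs.for (K := m) (fun l s' => s'.reg rValid = 1 ↔ ∀ a b : Fin m,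
        a < k ∨ ((a : ℕ) = k ∧ b < l) → (a ∈ A → b ∈ A → G.Adj a b → a ∈ Y ∨ b ∈ Y))
      (by decide) hN (fun s' hf => (hf.reg rN2 (by decide)).trans hm₁) ?_ ?_ ?_
    · simpa +decide using h₁
    · intro l s₂ hl hf₂ hr₂ h₂
      have hU₂ : s₂.reg rU = k := (hf₂.reg rU (by decide)).trans hr₁
      have hM₂ : s₂.mem = s.mem := funext fun a =>
        (hf₂.mem a List.not_mem_nil).trans (hf₁.mem a List.not_mem_nil)
      have e1 := hA.eq_one_iff ⟨k, hk⟩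
      have e2 := hA.eq_one_iff ⟨l, hl⟩
      have e3 := hY.eq_zero_iff ⟨k, hk⟩
      have e4 := hY.eq_zero_iff ⟨l, hl⟩
      have e5 := hG.eq_one_iff ⟨k, hk⟩ ⟨l, hl⟩
      refine Runs.when (fun hb => Runs.assign ?_) fun hb => ?_
      · simp only [Test.Holds, Expr.is, Expr.get1, Expr.eval, hr₂, hU₂, hM₂] at hb
        rw [e1, e2, e3, e4, e5] at hb
        rw [State.setReg_reg_of_ne _ _ (by decide), State.setReg_reg_self]
        simp only [Expr.eval, zero_ne_one, false_iff]
        intro h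
        have := h ⟨k, hk⟩ ⟨l, hl⟩ (Or.inr ⟨rfl, Nat.lt_succ_self l⟩) hb.1 hb.2.1 hb.2.2.1
        exact this.elim hb.2.2.2.1 hb.2.2.2.2
      · simp only [Test.Holds, Expr.is, Expr.get1, Expr.eval, hr₂, hU₂, hM₂] at hb
        rw [e1, e2, e3, e4, e5] at hb
        rw [State.setReg_reg_of_ne _ _ (by decide), h₂]
        refine ⟨fun h a b hab => ?_, fun h a b hab => h a b (by omega)⟩
        by_cases hd : (a : ℕ) < k ∨ ((a : ℕ) = k ∧ (b : ℕ) < l)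
        · exact h a b hd
        · obtain rfl : a = ⟨k, hk⟩ := Fin.ext (by dsimp only; omega)
          obtain rfl : b = ⟨l, hl⟩ := Fin.ext (by dsimp only at *; omega)
          intro ha hb' hab'
          by_contra hc
          exact hb ⟨ha, hb', hab', fun h => hc (Or.inl h), fun h => hc (Or.inr h)⟩
    · intro s₂ hf₂ hr₂ h₂
      rw [State.setReg_reg_of_ne _ _ (by decide), h₂]
      refine ⟨fun h a b hab => h a b (by omega), fun h a b hab => h a b (by omega)⟩
  · intro s₁ hf₁ hr₁ h₁
    rw [h₁]
    exact ⟨fun h a b => h a b a.2, fun h a b _ => h a b⟩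

theorem computeW_runs {G : SimpleGraph (Fin m)} {A Y : Set (Fin m)} (hm : s.reg rN2 = m)
    (hN : m ≤ N) (hG : HoldsGraph s aSq G) (hA : HoldsSet s aTT A) (hY : HoldsSet s aY Y) :
    Runs N computeW s fun s' => HoldsSet s' aW (forced G A Y) ∧
      HoldsSet s' aRest (remaining G A Y) := by
  refine Runs.for (K := m) (fun k s' => ∀ a : Fin m, a < k →
      ((a ∈ forced G A Y → s'.mem aW 0 a = 1) ∧ (a ∉ forced G A Y → s'.mem aW 0 a = 0)) ∧
      ((a ∈ remaining G A Y → s'.mem aRest 0 a = 1) ∧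
        (a ∉ remaining G A Y → s'.mem aRest 0 a = 0)))
    (by decide) hN (fun s' hf => (hf.reg rN2 (by decide)).trans hm) (by simp) ?_ ?_
  · intro k s₁ hk hf₁ hr₁ h₁
    have hm₁ : s₁.reg rN2 = m := (hf₁.reg rN2 (by decide)).trans hm
    have hA₁ := hA.of_mem_eq (hf₁.mem aTT (by decide))
    have hY₁ := hY.of_mem_eq (hf₁.mem aY (by decide))
    have hG₁ := hG.of_mem_eq (hf₁.mem aSq (by decide))
    have e1 := hA₁.eq_zero_iff ⟨k, hk⟩
    -- An iteration touches only the entries with index `k`, so it suffices to check these.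
    have hfin : ∀ s' : State, (∀ a : ℕ, a ≠ k → s'.mem aW 0 a = s₁.mem aW 0 a) →
        (∀ a : ℕ, a ≠ k → s'.mem aRest 0 a = s₁.mem aRest 0 a) →
        ((⟨k, hk⟩ ∈ forced G A Y → s'.mem aW 0 k = 1) ∧
          (⟨k, hk⟩ ∉ forced G A Y → s'.mem aW 0 k = 0)) →
        ((⟨k, hk⟩ ∈ remaining G A Y → s'.mem aRest 0 k = 1) ∧
          (⟨k, hk⟩ ∉ remaining G A Y → s'.mem aRest 0 k = 0)) →
        ∀ a : Fin m, a < k + 1 →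
        ((a ∈ forced G A Y → s'.mem aW 0 a = 1) ∧ (a ∉ forced G A Y → s'.mem aW 0 a = 0)) ∧
        ((a ∈ remaining G A Y → s'.mem aRest 0 a = 1) ∧
          (a ∉ remaining G A Y → s'.mem aRest 0 a = 0)) := by
      intro s' hw hr hwk hrk a ha
      by_cases hak : (a : ℕ) = k
      · obtain rfl : a = ⟨k, hk⟩ := Fin.ext hak
        exact ⟨hwk, hrk⟩
      · rw [hw a hak, hr a hak]
        exact h₁ a (by omega)
    refine Runs.seq (Runs.store1 (Runs.seq (Runs.store1 (Runs.when (fun hb => ?_) fun hb => ?_))))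
    · have hkA : (⟨k, hk⟩ : Fin m) ∉ A := by
        rw [← e1]
        simpa +decide [hr₁] using hb
      refine Runs.seq (Runs.for (K := m) (fun l s' =>
        (∀ a : ℕ, a ≠ k → s'.mem aW 0 a = s₁.mem aW 0 a) ∧
        ((∃ b : Fin m, b < l ∧ b ∈ A ∧ b ∉ Y ∧ G.Adj ⟨k, hk⟩ b) → s'.mem aW 0 k = 1) ∧
        ((¬ ∃ b : Fin m, b < l ∧ b ∈ A ∧ b ∉ Y ∧ G.Adj ⟨k, hk⟩ b) → s'.mem aW 0 k = 0))
        (by decide) hN (fun s' hf => ?_) ?_ ?_ ?_)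
      · simpa using (hf.reg rN2 (by decide)).trans hm₁
      · simp +decide [hr₁]
        grind
      · intro l s₂ hl hf₂ hr₂ h₂
        have hU₂ : s₂.reg rU = k := (hf₂.reg rU (by decide)).trans hr₁
        have f1 := hA₁.eq_one_iff ⟨l, hl⟩
        have f2 := hY₁.eq_zero_iff ⟨l, hl⟩
        have f3 := hG₁.eq_one_iff ⟨k, hk⟩ ⟨l, hl⟩
        have g1 : s₂.mem aTT = s₁.mem aTT := by
          simp +decide [hf₂.mem aTT (by decide), State.setMem_mem_of_ne]
        have g2 : s₂.mem aY = s₁.mem aY := by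
          simp +decide [hf₂.mem aY (by decide), State.setMem_mem_of_ne]
        have g3 : s₂.mem aSq = s₁.mem aSq := by
          simp +decide [hf₂.mem aSq (by decide), State.setMem_mem_of_ne]
        refine Runs.when (fun hb' => Runs.store1 ?_) fun hb' => ?_
        · simp only [Test.Holds, Expr.is, Expr.get1, Expr.eval, hr₂, hU₂, g1, g2, g3] at hb'
          rw [f1, f2, f3] at hb'
          simp only [State.setReg_mem, State.setMem_mem, Expr.eval, hU₂, true_and, and_self, if_true]
          refine ⟨fun a ha => ?_, fun _ => trivial, fun h => ?_⟩
          · rw [if_neg ha]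
            exact h₂.1 a ha
          · exact absurd ⟨⟨l, hl⟩, Nat.lt_succ_self l, hb'⟩ h
        · simp only [Test.Holds, Expr.is, Expr.get1, Expr.eval, hr₂, hU₂, g1, g2, g3] at hb'
          rw [f1, f2, f3] at hb'
          have hex : (∃ b : Fin m, b < l + 1 ∧ b ∈ A ∧ b ∉ Y ∧ G.Adj ⟨k, hk⟩ b) ↔
              ∃ b : Fin m, b < l ∧ b ∈ A ∧ b ∉ Y ∧ G.Adj ⟨k, hk⟩ b := by
            refine exists_congr fun b => and_congr_left fun hb'' => ⟨fun h => ?_, fun h => by omega⟩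
            refine lt_of_le_of_ne (Nat.lt_succ_iff.1 h) fun he => hb' ?_
            obtain rfl : b = ⟨l, hl⟩ := Fin.ext he
            exact hb''
          rw [State.setReg_mem, hex]
          exact h₂
      · intro s₂ hf₂ hr₂ h₂
        have hU₂ : s₂.reg rU = k := (hf₂.reg rU (by decide)).trans hr₁
        have hR₂ : ∀ a, s₂.mem aRest 0 a = if a = k then 0 else s₁.mem aRest 0 a := by
          intro a
          rw [hf₂.mem aRest (by decide)]
          simp +decide [hr₁]
        have hforced : (∃ b : Fin m, b < m ∧ b ∈ A ∧ b ∉ Y ∧ G.Adj ⟨k, hk⟩ b) ↔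
            (⟨k, hk⟩ : Fin m) ∈ forced G A Y :=
          ⟨fun ⟨b, _, hb⟩ => ⟨hkA, b, hb⟩, fun ⟨_, b, hb⟩ => ⟨b, b.2, hb⟩⟩
        rw [hforced] at h₂
        have hrem : (⟨k, hk⟩ : Fin m) ∈ remaining G A Y ↔ (⟨k, hk⟩ : Fin m) ∉ forced G A Y :=
          ⟨fun h => h.2, fun h => ⟨hkA, h⟩⟩
        refine Runs.when (fun hb' => Runs.store1 ?_) fun hb' => ?_
        all_goals
          simp [hU₂] at hb'
          refine hfin _ (fun a ha => ?_) (fun a ha => ?_) ?_ ?_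
          all_goals
            simp +decide [hU₂]
            grind
    · have hkA : (⟨k, hk⟩ : Fin m) ∈ A := by
        rw [← not_not (a := (⟨k, hk⟩ : Fin m) ∈ A), ← e1]
        simpa +decide [hr₁] using hb
      have w1 : (⟨k, hk⟩ : Fin m) ∉ forced G A Y := fun h => h.1 hkA
      have w2 : (⟨k, hk⟩ : Fin m) ∉ remaining G A Y := fun h => h.1 hkA
      refine hfin _ (fun a ha => ?_) (fun a ha => ?_) ?_ ?_
      all_goals
        simp +decide [hr₁]
        grind
  · exact fun s₁ hf₁ hr₁ h₁ => ⟨fun a => (h₁ a a.2).1, fun a => (h₁ a a.2).2⟩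

theorem computeX_runs {Y W Z : Set (Fin m)} (hm : s.reg rN2 = m) (hN : m ≤ N)
    (hY : HoldsSet s aY Y) (hW : HoldsSet s aW W) (hZ : HoldsSet s aZ Z) :
    Runs N computeX s fun s' => HoldsSet s' aX (Y ∪ W ∪ Z) := by
  refine Runs.for (K := m) (fun k s' => ∀ a : Fin m, a < k →
      (a ∈ Y ∪ W ∪ Z → s'.mem aX 0 a = 1) ∧ (a ∉ Y ∪ W ∪ Z → s'.mem aX 0 a = 0))
    (by decide) hN (fun s' hf => (hf.reg rN2 (by decide)).trans hm) (by simp) ?_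
    fun s₁ hf₁ hr₁ h₁ a => h₁ a a.2
  intro k s₁ hk hf₁ hr₁ h₁
  have e1 := hY ⟨k, hk⟩
  have e2 := hW ⟨k, hk⟩
  have e3 := hZ ⟨k, hk⟩
  have g1 : s₁.mem aY = s.mem aY := hf₁.mem aY (by decide)
  have g2 : s₁.mem aW = s.mem aW := hf₁.mem aW (by decide)
  have g3 : s₁.mem aZ = s.mem aZ := hf₁.mem aZ (by decide)
  refine Runs.ite (fun hb => Runs.store1 ?_) fun hb => Runs.store1 ?_
  all_goals
    intro a ha
    have h := h₁ a
    simp only [Test.Holds, Expr.get1, Expr.eval, hr₁, g1, g2, g3] at hb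
    simp +decide [hr₁]
    by_cases hak : (a : ℕ) = k
    · obtain rfl : a = ⟨k, hk⟩ := Fin.ext hak
      simp only [Set.mem_union] at *
      grind
    · simp only [Set.mem_union] at *
      grind

theorem computeSol_runs {X : Set (Fin (n + n))} (hn : s.reg rN = n) (hN : n ≤ N)
    (hX : HoldsSet s aX X) :
    Runs N computeSol s fun s' => HoldsSet s' aSol (bothCopies X) ∧
      ((bothCopies X).ncard < s.reg rK → s'.reg rFound = 1) ∧
      (s.reg rK ≤ (bothCopies X).ncard → s'.reg rFound = s.reg rFound) := by
  refine Runs.seq (Runs.assign (Runs.seq ?_))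
  refine Runs.for (K := n) (fun k s' => s'.reg rCount = countBelow (bothCopies X) k ∧
      ∀ v : Fin n, v < k →
        (v ∈ bothCopies X → s'.mem aSol 0 v = 1) ∧ (v ∉ bothCopies X → s'.mem aSol 0 v = 0))
    (by decide) hN (fun s' hf => ?_) (by simp +decide [countBelow_zero]) ?_ ?_
  · simp +decide [hf.reg rN (by decide), hn]
  · rintro k s₁ hk hf₁ hr₁ ⟨hc₁, h₁⟩
    have hn₁ : s₁.reg rN = n := by simp +decide [hf₁.reg rN (by decide), hn]
    have g1 : s₁.mem aX = s.mem aX := hf₁.mem aX (by decide)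
    have e1 := hX.eq_one_iff (copy₁ ⟨k, hk⟩)
    have e2 := hX.eq_one_iff (copy₂ ⟨k, hk⟩)
    have hc := countBelow_succ (bothCopies X) ⟨k, hk⟩
    have hmem : (⟨k, hk⟩ : Fin n) ∈ bothCopies X ↔ s.mem aX 0 k = 1 ∧ s.mem aX 0 (n + k) = 1 :=
      (and_congr e1 e2).symm
    have hfin : ∀ v : Fin n, v < k + 1 → v ≠ ⟨k, hk⟩ → v < k := fun v hv hne =>
      lt_of_le_of_ne (Nat.lt_succ_iff.1 hv) fun h => hne (Fin.ext h)
    dsimp only at hc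
    refine Runs.ite (fun hb => Runs.seq (Runs.store1 (Runs.assign ?_))) fun hb => Runs.store1 ?_
    all_goals
      simp only [Test.Holds, Expr.is, Expr.get1, Expr.eval, hr₁, hn₁, g1, ← hmem] at hb
      simp +decide [hr₁, hc, hb, hc₁]
      intro v hv
      by_cases hvk : v = ⟨k, hk⟩
      · subst hvk
        simp [hb]
      · have := h₁ v (hfin v (by omega) hvk)
        have : (v : ℕ) ≠ k := fun h => hvk (Fin.ext h)
        simpa [this] using h₁ v (hfin v (by omega) hvk)
  · rintro s₁ hf₁ hr₁ ⟨hc₁, h₁⟩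
    have hK₁ : s₁.reg rK = s.reg rK := by simp +decide [hf₁.reg rK (by decide)]
    have hF₁ : s₁.reg rFound = s.reg rFound := by simp +decide [hf₁.reg rFound (by decide)]
    rw [countBelow_self] at hc₁
    refine Runs.when (fun hb => Runs.assign ⟨fun v => h₁ v v.2, ?_⟩)
      fun hb => ⟨fun v => h₁ v v.2, ?_⟩
    · simp [hc₁, hK₁] at hb
      simp +decide [hb]
    · simp [hc₁, hK₁] at hb
      exact ⟨fun h => by omega, fun _ => hF₁⟩

end OCT

namespace OCT

open RAM

variable {n N : ℕ} {s s' : State} {H : SimpleGraph (Fin n)} {T : Finset (Fin n)}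
  {D D' : Set (Fin n)}

/-! ### The enumeration of the choices -/

open Classical in
/-- The number that is written by the first digits of the binary counter. -/
noncomputable def rank (T : Finset (Fin n)) (D : Set (Fin n)) (k : ℕ) : ℕ :=
  ∑ i ∈ Finset.range k, if h : i < n then
    (if ⟨i, h⟩ ∈ T ∧ ⟨i, h⟩ ∈ D then 2 ^ countBelow (T : Set (Fin n)) i else 0) else 0

open Classical in
theorem rank_succ (v : Fin n) : rank T D (v + 1) =
    rank T D v + if v ∈ T ∧ v ∈ D then 2 ^ countBelow (T : Set (Fin n)) v else 0 := by
  rw [rank, Finset.sum_range_succ, dif_pos v.2]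
  rfl

theorem rank_congr {k : ℕ} (h : ∀ v : Fin n, v < k → v ∈ T → (v ∈ D ↔ v ∈ D')) :
    rank T D k = rank T D' k := by
  refine Finset.sum_congr rfl fun i hi => ?_
  split
  · next hin =>
    have := h ⟨i, hin⟩ (Finset.mem_range.1 hi)
    grind
  · rfl

theorem rank_le_rank_univ (k : ℕ) : rank T D k ≤ rank T Set.univ k := by
  refine Finset.sum_le_sum fun i _ => ?_
  split
  · split
    · next h => rw [if_pos ⟨h.1, Set.mem_univ _⟩]
    · exact Nat.zero_le _
  · exact le_rfl

theorem rank_lt {k : ℕ} (hk : k ≤ n) : rank T D k < 2 ^ countBelow (T : Set (Fin n)) k := by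
  induction k with
  | zero => simp [rank]
  | succ k ih =>
    have h1 := rank_succ (T := T) (D := D) ⟨k, hk⟩
    have h2 := countBelow_succ (T : Set (Fin n)) ⟨k, hk⟩
    have h3 := ih (by omega)
    dsimp only at h1 h2
    rw [h1, h2]
    by_cases hT : (⟨k, hk⟩ : Fin n) ∈ T
    · rw [if_pos (Finset.mem_coe.2 hT), pow_succ]
      split <;> omega
    · simpa [hT] using h3

/-- Uniqueness of binary expansions: the lower digits contribute less than the weight of the top
digit, which is therefore determined. -/
theorem mem_iff_of_rank_eq {k : ℕ} (hk : k ≤ n) (h : rank T D k = rank T D' k) :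
    ∀ v : Fin n, v < k → v ∈ T → (v ∈ D ↔ v ∈ D') := by
  induction k with
  | zero => simp
  | succ k ih =>
    have h1 := rank_succ (T := T) (D := D) ⟨k, hk⟩
    have h2 := rank_succ (T := T) (D := D') ⟨k, hk⟩
    have h3 := rank_lt (T := T) (D := D) (k := k) (by omega)
    have h4 := rank_lt (T := T) (D := D') (k := k) (by omega)
    dsimp only at h1 h2
    rw [h1, h2] at h
    have hkD : (⟨k, hk⟩ : Fin n) ∈ T → ((⟨k, hk⟩ : Fin n) ∈ D ↔ (⟨k, hk⟩ : Fin n) ∈ D') := by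
      intro hT
      by_cases hD : (⟨k, hk⟩ : Fin n) ∈ D <;> by_cases hD' : (⟨k, hk⟩ : Fin n) ∈ D' <;>
        simp only [hT, hD, hD', and_self, and_false, if_true, if_false] at h ⊢ <;> omega
    have hr : rank T D k = rank T D' k := by
      by_cases hT : (⟨k, hk⟩ : Fin n) ∈ T
      · by_cases hD' : (⟨k, hk⟩ : Fin n) ∈ D' <;> simpa [hT, hkD hT, hD'] using h
      · simpa [hT] using h
    intro v hv hT
    rcases Nat.lt_succ_iff_lt_or_eq.1 hv with hlt | he
    · exact ih (by omega) hr v hlt hT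
    · obtain rfl : v = ⟨k, hk⟩ := Fin.ext he
      exact hkD hT

/-- The counter is decremented, and `rCarry` is the borrow: zeros become ones until a one is found,
which becomes zero. A borrow left at the end means that the counter stood at `0`. -/
theorem nextChoice_runs (hn : s.reg rN = n) (hN : n ≤ N) (hT : HoldsSet s aT (T : Set (Fin n)))
    (hY : HoldsSet s aY (choice T D)) :
    Runs N nextChoice s fun s' => ∃ D', HoldsSet s' aY (choice T D') ∧
      ((s'.reg rMore = 0 ∧ rank T D n = 0) ∨
        (s'.reg rMore = s.reg rMore ∧ rank T D' n + 1 = rank T D n)) := by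
  refine Runs.seq (Runs.assign (Runs.seq ?_))
  -- On the digits processed so far, new value plus one equals old value plus borrow times the
  -- weight of the next digit; later digits are untouched.
  refine Runs.for (K := n) (fun k s' => s'.reg rCarry ≤ 1 ∧ ∃ D', HoldsSet s' aY (choice T D') ∧
      (∀ v : Fin n, k ≤ v → (v ∈ D' ↔ v ∈ D)) ∧
      rank T D' k + 1 = rank T D k + s'.reg rCarry * 2 ^ countBelow (T : Set (Fin n)) k)
    (by decide) hN (fun s' hf => ?_) ⟨?_, D, hY, fun _ _ => Iff.rfl, ?_⟩ ?_ ?_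
  · simp +decide [hf.reg rN (by decide), hn]
  · simp +decide
  · simp +decide [rank, countBelow_zero]
  · rintro k s₁ hk hf₁ hr₁ ⟨hc, D', hY₁, hD', hrank⟩
    have hn₁ : s₁.reg rN = n := by simp +decide [hf₁.reg rN (by decide), hn]
    have hT₁ : HoldsSet s₁ aT (T : Set (Fin n)) := hT.of_mem_eq (hf₁.mem aT (by decide))
    have eT := hT₁.eq_one_iff ⟨k, hk⟩
    have eY := hY₁.eq_one_iff (copy₁ ⟨k, hk⟩)
    have h1 := rank_succ (T := T) (D := D) ⟨k, hk⟩
    have h3 := countBelow_succ (T : Set (Fin n)) ⟨k, hk⟩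
    have hkD := hD' ⟨k, hk⟩ le_rfl
    have hfin : ∀ (s₂ : State) (D'' : Set (Fin n)),
        s₂.reg rCarry ≤ 1 → (∀ v : Fin n, v ≠ ⟨k, hk⟩ → (v ∈ D'' ↔ v ∈ D')) →
        (∀ v : Fin n, v ≠ ⟨k, hk⟩ → s₂.mem aY 0 v = s₁.mem aY 0 v) →
        (∀ v : Fin n, v ≠ ⟨k, hk⟩ → s₂.mem aY 0 (n + v) = s₁.mem aY 0 (n + v)) →
        (⟨k, hk⟩ ∈ D'' → s₂.mem aY 0 k = 1 ∧ s₂.mem aY 0 (n + k) = 0) →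
        (⟨k, hk⟩ ∉ D'' → s₂.mem aY 0 k = 0 ∧ s₂.mem aY 0 (n + k) = 1) → ⟨k, hk⟩ ∈ T →
        HoldsSet s₂ aY (choice T D'') ∧ (∀ v : Fin n, k + 1 ≤ v → (v ∈ D'' ↔ v ∈ D)) ∧
        rank T D'' k = rank T D' k := by
      intro s₂ D'' _ hD'' m1 m2 m3 m4 hkT
      refine ⟨?_, fun v hv => ?_, ?_⟩
      · rw [HoldsSet, forall_copies]
        have q1 := fun v => hY₁ (copy₁ v)
        have q2 := fun v => hY₁ (copy₂ v)
        simp only [copy₁_val, copy₂_val, choice, copy₁_mem_lift, copy₂_mem_lift, Set.mem_inter_iff,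
          Set.mem_sdiff, Finset.mem_coe] at q1 q2 ⊢
        refine ⟨fun v => ?_, fun v => ?_⟩
        all_goals
          by_cases hv : v = ⟨k, hk⟩
          · subst hv
            simp only [hkT, true_and, not_not]
            tauto
          · simp only [hD'' v hv, m1 v hv, m2 v hv]
            first | exact q1 v | exact q2 v
      · rw [hD'' v fun h => by rw [h] at hv; exact absurd hv (by simp), hD' v (by omega)]
      · exact rank_congr fun v hv _ => hD'' v fun h => by rw [h] at hv; exact lt_irrefl _ hv
    have hne : ∀ v : Fin n, v ≠ ⟨k, hk⟩ → (v : ℕ) ≠ k := fun v hv h => hv (Fin.ext h)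
    refine Runs.when (fun hb => ?_) fun hb => ?_
    · simp only [Test.Holds, Expr.is, Expr.get1, Expr.eval, hr₁] at hb
      obtain ⟨hb1, hb2⟩ := hb
      have hkT : (⟨k, hk⟩ : Fin n) ∈ T := Finset.mem_coe.1 (eT.1 hb2)
      have hkY : s₁.mem aY 0 k = 1 ↔ (⟨k, hk⟩ : Fin n) ∈ D' := by
        refine eY.trans ?_
        simp [choice, hkT]
      rw [if_pos (Finset.mem_coe.2 hkT)] at h3
      rw [hb1] at hrank
      refine Runs.ite (fun hc' => Runs.seq (Runs.store1 (Runs.seq (Runs.store1 (Runs.assign ?_)))))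
        fun hc' => Runs.seq (Runs.store1 (Runs.store1 ?_))
      · simp only [Test.Holds, Expr.is, Expr.get1, Expr.eval, hr₁, hkY] at hc'
        rw [if_pos ⟨hkT, hkD.1 hc'⟩] at h1
        have h2 := rank_succ (T := T) (D := D' \ {⟨k, hk⟩}) ⟨k, hk⟩
        rw [if_neg (by simp)] at h2
        refine ⟨by simp +decide, D' \ {⟨k, hk⟩}, ?_⟩
        refine (fun ⟨a, b, c⟩ => ⟨a, b, ?_⟩ : _ → _) (hfin _ (D' \ {⟨k, hk⟩}) ?_ ?_ ?_ ?_ ?_ ?_ hkT)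
        · simp +decide
        · intro v hv
          simp [hv]
        · intro v hv
          have := v.2
          have := hne v hv
          simp +decide [hr₁, hn₁]
          grind
        · intro v hv
          have := hne v hv
          simp +decide [hr₁, hn₁]
          grind
        · simp
        · intro _
          simp +decide [hr₁, hn₁]
          omega
        · simp +decide
          dsimp only at h1 h2
          rw [h1, h2, c]
          omega
      · simp only [Test.Holds, Expr.is, Expr.get1, Expr.eval, hr₁, hkY] at hc'
        rw [if_neg fun h => hc' (hkD.2 h.2)] at h1
        have h2 := rank_succ (T := T) (D := insert ⟨k, hk⟩ D') ⟨k, hk⟩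
        rw [if_pos ⟨hkT, Set.mem_insert _ _⟩] at h2
        refine ⟨by simp +decide [hb1], insert ⟨k, hk⟩ D', ?_⟩
        refine (fun ⟨a, b, c⟩ => ⟨a, b, ?_⟩ : _ → _) (hfin _ (insert ⟨k, hk⟩ D') ?_ ?_ ?_ ?_ ?_ ?_ hkT)
        · simp +decide [hb1]
        · intro v hv
          simp [hv]
        · intro v hv
          have := v.2
          have := hne v hv
          simp +decide [hr₁, hn₁]
          grind
        · intro v hv
          have := hne v hv
          simp +decide [hr₁, hn₁]
          grind
        · intro _
          simp +decide [hr₁, hn₁]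
          omega
        · simp
        · simp +decide [hb1]
          dsimp only at h1 h2 h3
          rw [h1, h2, c, h3, pow_succ]
          omega
    · simp only [Test.Holds, Expr.is, Expr.get1, Expr.eval, hr₁] at hb
      have h2 := rank_succ (T := T) (D := D') ⟨k, hk⟩
      refine ⟨by simpa +decide using hc, D', hY₁, fun v hv => hD' v (by omega), ?_⟩
      have hcr : (s₁.setReg rV (k + 1)).reg rCarry = s₁.reg rCarry := by simp +decide
      -- An unchanged digit adds the same amount to both ranks.
      have hdiff : rank T D' (k + 1) + rank T D k = rank T D (k + 1) + rank T D' k := by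
        dsimp only at h1 h2
        by_cases hm : ⟨k, hk⟩ ∈ T ∧ ⟨k, hk⟩ ∈ D
        · rw [if_pos hm] at h1
          rw [if_pos ⟨hm.1, hkD.2 hm.2⟩] at h2
          omega
        · rw [if_neg hm] at h1
          rw [if_neg fun h => hm ⟨h.1, hkD.1 h.2⟩] at h2
          omega
      dsimp only at h3
      rw [hcr, h3]
      by_cases hc1 : s₁.reg rCarry = 1
      · have hkT : (⟨k, hk⟩ : Fin n) ∉ T := fun h => hb ⟨hc1, eT.2 (Finset.mem_coe.2 h)⟩
        rw [hc1] at hrank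
        rw [hc1, if_neg (by simpa using hkT), add_zero]
        omega
      · have hc0 : s₁.reg rCarry = 0 := by omega
        rw [hc0] at hrank ⊢
        omega
  · rintro s₁ hf₁ hr₁ ⟨hc, D', hY₁, -, hrank⟩
    have hM₁ : s₁.reg rMore = s.reg rMore := by simp +decide [hf₁.reg rMore (by decide)]
    refine Runs.when (fun hb => Runs.assign ⟨D', hY₁, Or.inl ⟨by simp, ?_⟩⟩)
      fun hb => ⟨D', hY₁, Or.inr ⟨hM₁, ?_⟩⟩
    · simp at hb
      rw [hb] at hrank
      have := rank_lt (T := T) (D := D') (k := n) le_rfl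
      omega
    · simp at hb
      have hc0 : s₁.reg rCarry = 0 := by omega
      rw [hc0] at hrank
      omega

end OCT

namespace OCT

open RAM

variable {n : ℕ} {H : SimpleGraph (Fin n)} {T : Finset (Fin n)}

/-! ### The main loop -/

/-- The memory contents that do not change in the main loop. -/
structure Prepared (H : SimpleGraph (Fin n)) (T : Finset (Fin n)) (s : State) : Prop where
  size : s.reg rN = n
  size_square : s.reg rN2 = n + n
  card : s.reg rK = T.card
  graph : HoldsGraph s aSq (square H)
  set : HoldsSet s aT (T : Set (Fin n))
  copies : HoldsSet s aTT (copies T)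

/-- This form serves for the subroutine, of which only the effect below `scratch` is known, not the
program text. -/
theorem Prepared.of_eq {s s' : State} (h : Prepared H T s) (h0 : s'.reg rN = s.reg rN)
    (h1 : s'.reg rN2 = s.reg rN2) (h2 : s'.reg rK = s.reg rK) (h3 : s'.mem aSq = s.mem aSq)
    (h4 : s'.mem aT = s.mem aT) (h5 : s'.mem aTT = s.mem aTT) : Prepared H T s' :=
  ⟨h0.trans h.size, h1.trans h.size_square, h2.trans h.card, h.graph.of_mem_eq h3,
    h.set.of_mem_eq h4, h.copies.of_mem_eq h5⟩

theorem Prepared.frame {s s' : State} {c : Cmd} (h : Prepared H T s) (hf : c.Frame s s')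
    (hc : (rN ∉ c.regs ∧ rN2 ∉ c.regs ∧ rK ∉ c.regs) ∧ aSq ∉ c.arrs ∧ aT ∉ c.arrs ∧
      aTT ∉ c.arrs := by decide) : Prepared H T s' :=
  h.of_eq (hf.reg _ hc.1.1) (hf.reg _ hc.1.2.1) (hf.reg _ hc.1.2.2) (hf.mem _ hc.2.1)
    (hf.mem _ hc.2.2.1) (hf.mem _ hc.2.2.2)

theorem prepare_runs {s : State} (hn : s.reg rN = n) (hH : HoldsGraph s aAdj H)
    (h0 : ∀ i j, s.mem aSq i j = 0) (hT : HoldsSet s aT (T : Set (Fin n))) :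
    Runs (n + n) buildSquare s fun s₁ => Runs (n + n) initChoice s₁ fun s' =>
      Prepared H T s' ∧ HoldsSet s' aY (choice T Set.univ) := by
  refine (buildSquare_runs hn (by omega) hH h0).mono fun s₁ hf₁ h₁ => ?_
  have hn₁ : s₁.reg rN = n := (hf₁.reg _ (by decide)).trans hn
  have hT₁ := hT.of_mem_eq (hf₁.mem aT (by decide))
  refine (initChoice_runs hn₁ (by omega) hT₁).mono fun s₂ hf₂ h₂ => ?_
  exact ⟨⟨(hf₂.reg _ (by decide)).trans hn₁, (hf₂.reg _ (by decide)).trans h₁.1, h₂.1,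
    h₁.2.of_mem_eq (hf₂.mem aSq (by decide)), hT₁.of_mem_eq (hf₂.mem aT (by decide)), h₂.2.1⟩,
    h₂.2.2⟩

/-- The body of the main loop up to the choice of the next `Y`. -/
def tryChoice (mvc : Cmd) : Cmd :=
  .when ((Expr.reg rValid).is 1) (computeW ;; mvc ;; computeX ;; computeSol)

/-- A bound for the running time of `tryChoice`, if the subroutine needs at most `t` steps. -/
noncomputable def tryTime (N t : ℕ) : ℕ :=
  3 + 1 + (computeW.timePoly.eval N + (t + (computeX.timePoly.eval N +
    computeSol.timePoly.eval N)) + 1)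

/-- The array `aSol` holds a set that may be returned. -/
def HoldsSolution (H : SimpleGraph (Fin n)) (T : Finset (Fin n)) (s : State) : Prop :=
  ∃ T' : Finset (Fin n), IsDisjointCompression H T T' ∧ HoldsSet s aSol (T' : Set (Fin n))

/-- Whatever is found is a solution, since `X` is a vertex cover with exactly one copy of each
vertex of `T`; if nothing is found, optimality of `X` rules out a compression with this `D`. -/
theorem tryChoice_runs {s : State} {D : Set (Fin n)} {mvc : Cmd} {p : Polynomial ℕ}
    (hp : ∀ (m : ℕ) (G : SimpleGraph (Fin m)) (U : Set (Fin m)) (s : State),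
      (G.induce U).IsBipartite → s.reg rN2 = m → HoldsGraph s aSq G → HoldsSet s aRest U →
      ∃ (t : ℕ) (s' : State), Exec mvc s t s' ∧ t ≤ p.eval m ∧
        (∃ Z : Set U, (G.induce U).IsVertexCover Z ∧ Z.encard = (G.induce U).vertexCoverNum ∧
          HoldsSet s' aZ (Subtype.val '' Z)) ∧
        (∀ x < scratch, s'.reg x = s.reg x) ∧
        (∀ a < scratch, a ≠ aZ → s'.mem a = s.mem a))
    (hT : IsOCT H T) (hs : Prepared H T s) (hY : HoldsSet s aY (choice T D))
    (hvalid : s.reg rValid = 1 ↔ CoversOn (square H) (copies T) (choice T D))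
    (hfound : s.reg rFound = 0) :
    RunsIn (tryTime (n + n) (p.eval (n + n))) (tryChoice mvc) s fun s' => Prepared H T s' ∧
      HoldsSet s' aY (choice T D) ∧ s'.reg rMore = s.reg rMore ∧
      ((s'.reg rFound = 1 ∧ HoldsSolution H T s') ∨
        (s'.reg rFound = 0 ∧ ¬ HasCompression H T D)) := by
  refine RunsIn.ite (T₂ := 1) (fun hb => ?_) fun hb => ⟨_, s, .skip s, le_rfl, hs, hY, rfl, Or.inr
    ⟨hfound, fun h => hb (hvalid.2 h.coversOn)⟩⟩
  have hcov := hvalid.1 hb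
  refine RunsIn.seq ((computeW_runs hs.size_square le_rfl hs.graph hs.copies hY).mono
    fun s₁ hf₁ h₁ => ?_)
  have hs₁ := hs.frame hf₁
  have hY₁ := hY.of_mem_eq (hf₁.mem aY (by decide))
  obtain ⟨t, s₂, hexec, ht, ⟨Z, hZ, hZmin, hZ₂⟩, hreg, hmem⟩ := hp _ _ _ s₁
    (isBipartite_remaining hT _) hs₁.size_square hs₁.graph h₁.2
  have hs₂ : Prepared H T s₂ := hs₁.of_eq (hreg _ (by decide)) (hreg _ (by decide))
    (hreg _ (by decide)) (hmem _ (by decide) (by decide)) (hmem _ (by decide) (by decide))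
    (hmem _ (by decide) (by decide))
  have hY₂ := hY₁.of_mem_eq (hmem aY (by decide) (by decide))
  have hW₂ := h₁.1.of_mem_eq (hmem aW (by decide) (by decide))
  refine RunsIn.seq ⟨t, s₂, hexec, ht, ?_⟩
  refine RunsIn.seq ((computeX_runs hs₂.size_square le_rfl hY₂ hW₂ hZ₂).mono fun s₃ hf₃ h₃ => ?_)
  have hs₃ := hs₂.frame hf₃
  have hX₃ : HoldsSet s₃ aX (cover T D Z) := h₃
  refine (computeSol_runs hs₃.size (by omega) hX₃).mono fun s₄ hf₄ ⟨hsol, hlt, hle⟩ => ?_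
  have hXcov := isVertexCover_cover hcov hZ
  refine ⟨hs₃.frame hf₄, (hY₂.of_mem_eq (hf₃.mem aY (by decide))).of_mem_eq
    (hf₄.mem aY (by decide)), ?_, ?_⟩
  · exact (hf₄.reg _ (by decide)).trans ((hf₃.reg _ (by decide)).trans
      ((hreg _ (by decide)).trans (hf₁.reg _ (by decide))))
  · have hK := hs₃.card
    rcases lt_or_ge (bothCopies (cover T D Z)).ncard (s₃.reg rK) with h | h
    · obtain ⟨T', hT'⟩ := (Set.toFinite (bothCopies (cover T D Z))).exists_finset_coe
      refine Or.inl ⟨hlt h, T', ⟨?_, ?_, ?_⟩, hT' ▸ hsol⟩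
      · refine isOCT_iff_exists.2 ⟨copy₁ ⁻¹' cover T D Z, fun u v huv hu hv => ?_⟩
        rw [← Finset.mem_coe, hT'] at hu hv
        exact colouring_of_isVertexCover hXcov u v huv hu hv
      · rw [← hT', Set.ncard_coe_finset, hK] at h
        omega
      · refine Finset.disjoint_left.2 fun v hv hv' => ?_
        rw [← Finset.mem_coe, hT'] at hv'
        exact disjoint_bothCopies_cover hv hv'
    · refine Or.inr ⟨(hle h).trans ?_, fun hcomp => ?_⟩
      · exact (hf₃.reg _ (by decide)).trans ((hreg _ (by decide)).trans
          ((hf₁.reg _ (by decide)).trans hfound))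
      · have := hcomp.ncard_lt hZ hZmin
        omega

/-- The invariant of the main loop, if at most `k` more choices are left to be tried. -/
structure LoopInv (H : SimpleGraph (Fin n)) (T : Finset (Fin n)) (k : ℕ) (s : State) : Prop where
  prepared : Prepared H T s
  found : s.reg rFound = 0 ∨ s.reg rFound = 1
  solution : s.reg rFound = 1 → HoldsSolution H T s
  more : s.reg rMore = 0 ∨ s.reg rMore = 1
  failed : s.reg rFound = 0 → s.reg rMore = 0 → ∀ D, ¬ HasCompression H T D
  untried : s.reg rFound = 0 → s.reg rMore = 1 → ∃ D, HoldsSet s aY (choice T D) ∧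
    rank T D n < k ∧ ∀ D', rank T D n < rank T D' n → ¬ HasCompression H T D'

/-- The rank of the current choice is less than the number of iterations left and drops by one each
time. The constant `7` is the cost of the loop test. -/
theorem loop_runs {s : State} {mvc : Cmd} {p : Polynomial ℕ}
    (hp : ∀ (m : ℕ) (G : SimpleGraph (Fin m)) (U : Set (Fin m)) (s : State),
      (G.induce U).IsBipartite → s.reg rN2 = m → HoldsGraph s aSq G → HoldsSet s aRest U →
      ∃ (t : ℕ) (s' : State), Exec mvc s t s' ∧ t ≤ p.eval m ∧
        (∃ Z : Set U, (G.induce U).IsVertexCover Z ∧ Z.encard = (G.induce U).vertexCoverNum ∧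
          HoldsSet s' aZ (Subtype.val '' Z)) ∧
        (∀ x < scratch, s'.reg x = s.reg x) ∧
        (∀ a < scratch, a ≠ aZ → s'.mem a = s.mem a))
    (hT : IsOCT H T) (hs : LoopInv H T (2 ^ T.card) s) :
    RunsIn (2 ^ T.card * (7 + 1 + (checkChoice.timePoly.eval (n + n) +
        (tryTime (n + n) (p.eval (n + n)) + nextChoice.timePoly.eval (n + n)))) + (7 + 1))
      (.while ((Expr.reg rMore).is 1 AND (Expr.reg rFound).is 0)
        (checkChoice ;; tryChoice mvc ;; nextChoice)) s fun s' =>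
      (s'.reg rFound = 0 ∨ s'.reg rFound = 1) ∧
      (s'.reg rFound = 1 ↔ ∃ T', IsDisjointCompression H T T') ∧
      (s'.reg rFound = 1 → HoldsSolution H T s') := by
  refine RunsIn.while (LoopInv H T) hs ?_ ?_
  · rintro k s₁ - ⟨hmore, hfound⟩ hI
    obtain ⟨D, hY, hk, hD⟩ := hI.untried hfound hmore
    refine ⟨by omega, RunsIn.seq ?_⟩
    have hs₁ := hI.prepared
    refine (checkChoice_runs hs₁.size_square le_rfl hs₁.graph hs₁.copies hY).mono
      fun s₂ hf₂ hvalid => RunsIn.seq ?_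
    refine (tryChoice_runs hp hT (hs₁.frame hf₂) (hY.of_mem_eq (hf₂.mem aY (by decide))) hvalid
      ((hf₂.reg _ (by decide)).trans hfound)).mono le_rfl fun s₃ _ ⟨hs₃, hY₃, hmore₃, h₃⟩ => ?_
    replace hmore₃ : s₃.reg rMore = 1 := hmore₃.trans ((hf₂.reg _ (by decide)).trans hmore)
    refine (nextChoice_runs hs₃.size (by omega) hs₃.set hY₃).mono fun s₄ hf₄ ⟨D', hY₄, h₄⟩ => ?_
    have hfound₄ : s₄.reg rFound = s₃.reg rFound := hf₄.reg _ (by decide)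
    have hsol₄ : s₄.mem aSol = s₃.mem aSol := hf₄.mem _ (by decide)
    -- Higher ranks failed earlier, and equal rank means the same choice on `T`, which has just
    -- failed.
    have hfailed : s₄.reg rFound = 0 → ∀ D'', rank T D n ≤ rank T D'' n →
        ¬ HasCompression H T D'' := by
      intro h0 D'' hle
      have hDfail : ¬ HasCompression H T D := by
        rcases h₃ with h | h
        · omega
        · exact h.2
      rcases hle.lt_or_eq with hlt | heq
      · exact hD D'' hlt
      · exact fun h => hDfail (h.congr fun v hv => (mem_iff_of_rank_eq le_rfl heq v v.2 hv).symm)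
    refine ⟨hs₃.frame hf₄, ?_, fun h1 => ?_, ?_, fun h0 hm => ?_, fun h0 hm => ?_⟩
    · rw [hfound₄]
      exact h₃.symm.imp And.left And.left
    · obtain ⟨T', h, h'⟩ := (h₃.resolve_right fun h => by omega).2
      exact ⟨T', h, h'.of_mem_eq hsol₄⟩
    · exact h₄.imp And.left fun h => h.1.trans hmore₃
    · rcases h₄ with h | h
      · exact fun D'' => hfailed h0 D'' (by omega)
      · omega
    · rcases h₄ with h | h
      · omega
      · exact ⟨D', hY₄, by omega, fun D'' hlt => hfailed h0 D'' (by omega)⟩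
  · intro k s₁ _ hb hI
    have hno : s₁.reg rFound = 0 → ∀ D, ¬ HasCompression H T D := fun h0 =>
      hI.failed h0 (hI.more.resolve_right fun h => hb ⟨h, h0⟩)
    refine ⟨hI.found, ⟨fun h => ?_, fun ⟨T', h⟩ => ?_⟩, hI.solution⟩
    · obtain ⟨T', h', -⟩ := hI.solution h
      exact ⟨T', h'⟩
    · obtain ⟨D, hD⟩ := exists_hasCompression h
      exact hI.found.resolve_left fun h0 => hno h0 D hD

/-! ### The input memory and the total running time. -/

theorem holdsGraph_inputState : HoldsGraph (inputState H T) aAdj H := by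
  refine fun u v => ⟨fun h => ?_, fun h => ?_⟩
  · simp only [inputState]
    exact if_pos ⟨rfl, u, v, rfl, rfl, h⟩
  · simp only [inputState]
    rw [if_neg, if_neg (by simp)]
    rintro ⟨-, a, b, ha, hb, hab⟩
    exact h (Fin.ext ha ▸ Fin.ext hb ▸ hab)

theorem holdsSet_inputState : HoldsSet (inputState H T) aT (T : Set (Fin n)) := by
  intro v
  simp [inputState, Fin.val_inj]

theorem disjointCompression_runs {mvc : Cmd} (hmvc : IsBipartiteVertexCoverRoutine mvc) :
    ∃ p : Polynomial ℕ, ∀ (n : ℕ) (H : SimpleGraph (Fin n)) (T : Finset (Fin n)), IsOCT H T →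
      RunsIn (2 ^ T.card * p.eval n) (disjointCompression mvc) (inputState H T) fun s =>
        (s.reg rFound = 0 ∨ s.reg rFound = 1) ∧
        (s.reg rFound = 1 ↔ ∃ T' : Finset (Fin n), IsDisjointCompression H T T') ∧
        (s.reg rFound = 1 → HoldsSolution H T s) := by
  obtain ⟨p, hp⟩ := hmvc
  -- The `12` pays for two constant assignments and the last loop test (`2 + 2 + 8`), the `13` for
  -- the loop test and the conditional in each iteration (`8 + 5`). The polynomial is evaluated at
  -- `n + n`, the size of `H²`.
  refine ⟨(buildSquare.timePoly + initChoice.timePoly + 12 + (13 + checkChoice.timePoly +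
    computeW.timePoly + p + computeX.timePoly + computeSol.timePoly +
    nextChoice.timePoly)).comp (Polynomial.X + Polynomial.X), fun n H T hT => ?_⟩
  refine RunsIn.mono (RunsIn.seq (RunsIn.mono (prepare_runs (s := inputState H T)
    (by simp [inputState]) holdsGraph_inputState (by simp [inputState]) holdsSet_inputState)
    le_rfl fun s₁ _ h₁ => RunsIn.seq (RunsIn.mono h₁ le_rfl fun s₂ _ ⟨hs₂, hY₂⟩ =>
    RunsIn.seq (T₁ := 2) ⟨_, _, .assign _ _ _, le_rfl, RunsIn.seq (T₁ := 2)
      ⟨_, _, .assign _ _ _, le_rfl, loop_runs hp hT ?_⟩⟩))) ?_ fun _ _ h => h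
  -- The first choice `T₁` belongs to `D = univ`, which has the highest rank, so nothing has been
  -- skipped.
  · have hrank := rank_lt (T := T) (D := Set.univ) (le_refl n)
    rw [countBelow_self, Set.ncard_coe_finset] at hrank
    refine ⟨hs₂.of_eq ?_ ?_ ?_ rfl rfl rfl, Or.inl ?_, fun h => ?_, Or.inr ?_, fun _ h => ?_,
      fun _ _ => ⟨Set.univ, hY₂, hrank, fun D' hlt => ?_⟩⟩
    · simp +decide
    · simp +decide
    · simp +decide
    · simp +decide
    · simp +decide at h
    · simp +decide
    · simp +decide at h
    · exact absurd hlt (rank_le_rank_univ n).not_gt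
  · have hpow : 1 ≤ 2 ^ T.card := Nat.one_le_two_pow
    simp only [Polynomial.eval_comp, Polynomial.eval_add, Polynomial.eval_X, Polynomial.eval_ofNat,
      tryTime]
    set K := 2 ^ T.card
    generalize buildSquare.timePoly.eval (n + n) = a
    generalize initChoice.timePoly.eval (n + n) = b
    generalize checkChoice.timePoly.eval (n + n) = c
    generalize computeW.timePoly.eval (n + n) = d
    generalize p.eval (n + n) = e
    generalize computeX.timePoly.eval (n + n) = f
    generalize computeSol.timePoly.eval (n + n) = g
    generalize nextChoice.timePoly.eval (n + n) = h
    have : a + b + 12 ≤ K * (a + b + 12) := Nat.le_mul_of_pos_left _ hpow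
    nlinarith

end OCT

theorem mainTheorem1 :
    (∃ mvc : RAM.Cmd, OCT.IsBipartiteVertexCoverRoutine mvc) ∧
    ∀ mvc : RAM.Cmd, OCT.IsBipartiteVertexCoverRoutine mvc →
      ∃ p : Polynomial ℕ, ∀ (n : ℕ) (H : SimpleGraph (Fin n)) (T : Finset (Fin n)),
        OCT.IsOCT H T →
        ∃ (t : ℕ) (s : RAM.State),
          RAM.Exec (OCT.disjointCompression mvc) (OCT.inputState H T) t s ∧
          t ≤ 2 ^ T.card * p.eval n ∧
          (s.reg OCT.rFound = 0 ∨ s.reg OCT.rFound = 1) ∧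
          (s.reg OCT.rFound = 1 ↔ ∃ T' : Finset (Fin n), OCT.IsDisjointCompression H T T') ∧
          (s.reg OCT.rFound = 1 → ∃ T' : Finset (Fin n), OCT.IsDisjointCompression H T T' ∧
            OCT.HoldsSet s OCT.aSol (T' : Set (Fin n))) :=
  ⟨⟨_, BipartiteCover.minCover_isBipartiteVertexCoverRoutine⟩,
    -- The statement is `RunsIn` and `HoldsSolution` unfolded.
    fun _ hmvc => OCT.disjointCompression_runs hmvc⟩
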